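/- Let $N\ge 0$, let $\Omega\subseteq\mathbb{R}^N$ be measurable, and let $\mathcal H=L^2(\Omega;\mathbb{C})$ with the inner product $\langle f,g\rangle=\int_\Omega\overline{f}\,g\,dx$. Let $H$ be a (possibly unbounded) self-adjoint operator on $\mathcal H$ with domain $D(H)$, let $\mu,O$ be bounded self-adjoint operators on $\mathcal H$, and let $\psi_0\in\mathcal H$, $T>0$, $\alpha>0$. Let $\delta,\eta\in[0,2]$ with $(\delta,\eta)\notin\{(0,2),(2,0),(2,2)\}$. For $e\in L^2([0,T];\mathbb{R})$, $t_0\in\{0,T\}$ and $\varphi_0\in\mathcal H$, a solution of $i\partial_t\varphi=(H-e(t)\mu)\varphi$, $\varphi(t_0)=\varphi_0$, is a function $\varphi\in C([0,T];\mathcal H)$ with $\varphi(t_0)=\varphi_0$ such that, for all $v\in D(H)$ and $t\in[0,T]$, $$\langle v,\varphi(t)\rangle=\langle v,\varphi_0\rangle-i\int_{t_0}^t\bigl(\langle Hv,\varphi(s)\rangle-e(s)\langle v,\mu\varphi(s)\rangle\bigr)\,ds .$$ Let $\varepsilon^k,\widetilde\varepsilon^{\,k}\in L^2([0,T];\mathbb{R})$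 and $\psi^k,\chi^k$ ($k\ge 0$) be generated by the monotonic scheme, that is, with arbitrary initial guesses $\varepsilon^0,\widetilde\varepsilon^{\,0}\in L^2([0,T];\mathbb{R})$: - for $k\ge 0$, $\psi^k$ solves $i\partial_t\psi^k=(H-\varepsilon^k(t)\mu)\psi^k$, $\psi^k(0)=\psi_0$; - for $k\ge 1$, $\varepsilon^k(t)=(1-\delta)\widetilde\varepsilon^{\,k-1}(t)-\frac{\delta}{\alpha}\operatorname{Im}\langle\chi^{k-1}(t),\mu\psi^k(t)\rangle$ for a.e. $t\in[0,T]$; - for $k\ge 0$, $\chi^k$ solves $i\partial_t\chi^k=(H-\widetilde\varepsilon^{\,k}(t)\mu)\chi^k$, $\chi^k(T)=O\psi^k(T)$; - for $k\ge 1$, $\widetilde\varepsilon^{\,k}(t)=(1-\eta)\varepsilon^k(t)-\frac{\eta}{\alpha}\operatorname{Im}\langle\chi^k(t),\mu\psi^k(t)\rangle$ for a.e. $t\in[0,T]$. Let $A$ be the set of limit points of $(\varepsilon^k)_k$, i.e. of the limits in $L^2([0,T];\mathbb{R})$ of its norm-convergent subsequences. Then $A$ is compact in $L^2([0,T];\mathbb{R})$.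 -/

import Mathlib

open MeasureTheory Filter Topology Set

noncomputable section

/-- The state space `L²(Ω; ℂ)` for a set `Ω` of `ℝᴺ` with Lebesgue measure. -/
abbrev StateSpace {N : ℕ} (Ω : Set (EuclideanSpace ℝ (Fin N))) : Type :=
  Lp ℂ 2 ((volume : Measure (EuclideanSpace ℝ (Fin N))).restrict Ω)

/-- The space of controls `L²([0,T]; ℝ)`. -/
abbrev ControlSpace (T : ℝ) : Type :=
  Lp ℝ 2 ((volume : Measure ℝ).restrict (Icc 0 T))

section Schrodinger

variable {E : Type*} [NormedAddCommGroup E] [InnerProductSpace ℂ E] [CompleteSpace E]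

/-- `φ ∈ C([0,T]; E)` is the (weak, equivalently mild) solution on `[0,T]` of
`i ∂φ/∂t = (H - e(t) μ) φ`, `φ(t₀) = φ₀`, where `H` is a possibly unbounded self-adjoint operator
and `μ` is bounded. The equation is tested against the vectors of the domain of `H`
and integrated in time from `t₀` (the integral is oriented, so `t₀ = T` gives a backward
equation):
`⟨v, φ(t)⟩ = ⟨v, φ₀⟩ - i ∫_{t₀}^t (⟨H v, φ(s)⟩ - e(s) ⟨v, μ φ(s)⟩) ds`. -/
structure IsSchrodingerSolution (H : E →ₗ.[ℂ] E) (μ : E →L[ℂ] E) {T : ℝ} (e : ControlSpace T)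
    (t₀ : ℝ) (φ₀ : E) (φ : ℝ → E) : Prop where
  continuousOn : ContinuousOn φ (Icc 0 T)
  initial : φ t₀ = φ₀
  equation : ∀ v : H.domain, ∀ t ∈ Icc 0 T,
    inner ℂ (v : E) (φ t) = inner ℂ (v : E) φ₀ -
      Complex.I * ∫ s in t₀..t,
        (inner ℂ (H v) (φ s) - ((e s : ℝ) : ℂ) * inner ℂ (v : E) (μ (φ s)))

/-- `(ε k)`, `(ε' k)`, `(ψ k)`, `(χ k)` are generated by the monotonic scheme with parameters
`δ`, `η` and penalty `α`; here `ε'` is the second control, written `ε̃` on paper.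
The control `ε'` at step `0`, like `ε 0`, is an arbitrary initial guess; computing it from
`ε 0` by the update formula of `ε'` is a special case. -/
structure IsMonotonicScheme (H : E →ₗ.[ℂ] E) (μ O : E →L[ℂ] E) (ψ₀ : E) (T α δ η : ℝ)
    (ε ε' : ℕ → ControlSpace T) (ψ χ : ℕ → ℝ → E) : Prop where
  state : ∀ k, IsSchrodingerSolution H μ (ε k) 0 ψ₀ (ψ k)
  control : ∀ k, ∀ᵐ t ∂((volume : Measure ℝ).restrict (Icc 0 T)),
    ε (k + 1) t = (1 - δ) * ε' k t - δ / α * (inner ℂ (χ k t) (μ (ψ (k + 1) t))).im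
  adjointState : ∀ k, IsSchrodingerSolution H μ (ε' k) T (O (ψ k T)) (χ k)
  adjointControl : ∀ k, 1 ≤ k → ∀ᵐ t ∂((volume : Measure ℝ).restrict (Icc 0 T)),
    ε' k t = (1 - η) * ε k t - η / α * (inner ℂ (χ k t) (μ (ψ k t))).im

end Schrodinger

/-- The set of limit points of a sequence: the limits of its convergent subsequences. -/
def limitPoints {X : Type*} [TopologicalSpace X] (u : ℕ → X) : Set X :=
  {a | ∃ n : ℕ → ℕ, StrictMono n ∧ Tendsto (fun j => u (n j)) atTop (𝓝 a)}

end

/-! Eliminating the second control gives `ε (k+2) = ((1-δ)(1-η)) • ε (k+1) + b k`, where `b k` is a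
fixed linear combination of the functions `Im ⟨χ, μ ψ⟩`. Outside the excluded corners the factor has
modulus less than one, except when `δ = η = 0`, where the sequence is constant from index 1 on. The
orbit of a contraction perturbed by vectors of a compact set is totally bounded, and the limit
points of a totally bounded sequence in a complete space form a compact set. It remains to put all
`b k` in one compact subset of `L²`.

Conservation of the norm bounds `ψ` and `χ` independently of the controls, hence bounds `b k`, and
the contraction then bounds the controls in `L²`. The free evolution `U t` is not a compact
operator, but solutions with bounded controls and initial data in a compact set still take values in
a compact set. Indeed, in Duhamel's formula the integral term maps values close to a
finite-dimensional space to values closer, by a factor 3/4 in an exponentially weighted norm, to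
another such space (`exists_finiteDimensional_approx_succ`); iteration gives total boundedness. On a
compact set of values `U t` tends to the identity uniformly, so Duhamel also gives equicontinuity.
Ascoli then makes the functions `Im ⟨χ, μ ψ⟩` relatively compact.

Conservation of the norm and Duhamel's formula must be drawn from the weak equation. The resolvent
turns it into a strong equation for `(H + i r)⁻¹ φ`, to which a product rule for absolutely
continuous functions applies. The unitary group is built from Yosida approximations, and both
identities follow by letting the regularization parameter tend to infinity. -/

noncomputable section

/-! ### Resolvents and Yosida approximations of a self-adjoint operator. -/

section SelfAdjointOperator

variable {E : Type*} [NormedAddCommGroup E] [InnerProductSpace ℂ E] [CompleteSpace E]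
  {H : E →ₗ.[ℂ] E}

theorem LinearPMap.inner_apply_left (hH : IsSelfAdjoint H) (u v : H.domain) :
    inner ℂ (H u) (v : E) = inner ℂ (u : E) (H v) := by
  have h := LinearPMap.adjoint_isFormalAdjoint (T := H) hH.dense_domain
  rw [LinearPMap.isSelfAdjoint_def.mp hH] at h
  exact h u v

theorem LinearPMap.exists_domain_of_inner (hH : IsSelfAdjoint H) {x w : E}
    (h : ∀ u : H.domain, inner ℂ w (u : E) = inner ℂ x (H u)) :
    ∃ y : H.domain, (y : E) = x ∧ H y = w := by
  have hx : x ∈ H.adjoint.domain := LinearPMap.mem_adjoint_domain_of_exists x ⟨w, h⟩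
  have hw : H.adjoint ⟨x, hx⟩ = w :=
    LinearPMap.adjoint_apply_eq hH.dense_domain ⟨x, hx⟩ fun u => h u
  have hs := LinearPMap.isSelfAdjoint_def.mp hH
  -- The domain is part of the type of the argument, so the equality of operators is used by
  -- substitution, on a variable `A`.
  have key : ∀ A : E →ₗ.[ℂ] E, A = H → ∀ hx : x ∈ A.domain, A ⟨x, hx⟩ = w →
      ∃ y : H.domain, (y : E) = x ∧ H y = w := by
    rintro A rfl hx hw
    exact ⟨⟨x, hx⟩, rfl, hw⟩
  exact key _ hs hx hw

/-- The cross term is the real part of `i r ⟨H v, v⟩`, and `⟨H v, v⟩` is real. -/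
theorem LinearPMap.norm_sq_apply_add_smul (hH : IsSelfAdjoint H) (r : ℝ) (v : H.domain) :
    ‖H v + ((r : ℂ) * Complex.I) • (v : E)‖ ^ 2 = ‖H v‖ ^ 2 + r ^ 2 * ‖(v : E)‖ ^ 2 := by
  have him : (inner ℂ (H v) (v : E)).im = 0 := by
    rw [← Complex.conj_eq_iff_im, inner_conj_symm, LinearPMap.inner_apply_left hH]
  rw [norm_add_sq (𝕜 := ℂ), inner_smul_right, norm_smul]
  simp [him, mul_pow]

theorem LinearPMap.abs_mul_norm_le (hH : IsSelfAdjoint H) (r : ℝ) (v : H.domain) :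
    |r| * ‖(v : E)‖ ≤ ‖H v + ((r : ℂ) * Complex.I) • (v : E)‖ := by
  refine le_of_sq_le_sq ?_ (norm_nonneg _)
  rw [LinearPMap.norm_sq_apply_add_smul hH, mul_pow, sq_abs]
  nlinarith [sq_nonneg ‖H v‖]

/-- `H + i r` maps the domain of the self-adjoint operator `H` onto the whole space. -/
theorem LinearPMap.exists_apply_add_smul_eq (hH : IsSelfAdjoint H) {r : ℝ} (hr : r ≠ 0) (w : E) :
    ∃ v : H.domain, H v + ((r : ℂ) * Complex.I) • (v : E) = w := by
  have hr' : 0 < |r| := abs_pos.mpr hr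
  let A : H.domain →ₗ[ℂ] E := H.toFun + ((r : ℂ) * Complex.I) • H.domain.subtype
  have hA : ∀ v : H.domain, A v = H v + ((r : ℂ) * Complex.I) • (v : E) := fun v => rfl
  -- By the lower bound, preimages of a convergent sequence are Cauchy; self-adjointness puts their
  -- limit in the domain.
  have hclosed : _root_.IsClosed (LinearMap.range A : Set E) := by
    refine isClosed_of_closure_subset fun y hy => ?_
    obtain ⟨u, hu, hlim⟩ := mem_closure_iff_seq_limit.mp hy
    choose v hv using hu
    have hcauchy : CauchySeq fun n => (v n : E) := by
      rw [Metric.cauchySeq_iff]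
      intro ε hε
      obtain ⟨n₀, hn₀⟩ := Metric.cauchySeq_iff.mp hlim.cauchySeq (|r| * ε) (by positivity)
      refine ⟨n₀, fun m hm n hn => ?_⟩
      have h1 := hn₀ m hm n hn
      rw [← hv m, ← hv n, dist_eq_norm, ← _root_.map_sub, hA] at h1
      have h2 := (LinearPMap.abs_mul_norm_le hH r (v m - v n)).trans_lt h1
      rw [dist_eq_norm]
      exact lt_of_mul_lt_mul_left h2 hr'.le
    obtain ⟨x, hx⟩ := cauchySeq_tendsto_of_complete hcauchy
    have hHv : Tendsto (fun n => H (v n)) atTop (𝓝 (y - ((r : ℂ) * Complex.I) • x)) := by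
      refine (hlim.sub (hx.const_smul ((r : ℂ) * Complex.I))).congr fun n => ?_
      rw [← hv n, hA, add_sub_cancel_right]
    obtain ⟨z, hz, hHz⟩ := LinearPMap.exists_domain_of_inner hH
      (x := x) (w := y - ((r : ℂ) * Complex.I) • x) fun q => by
        refine tendsto_nhds_unique (hHv.inner tendsto_const_nhds) ?_
        refine (hx.inner tendsto_const_nhds).congr fun n => ?_
        rw [LinearPMap.inner_apply_left hH]
    refine ⟨z, ?_⟩
    rw [hA, hHz, hz, sub_add_cancel]
  have hcomplete : IsComplete (LinearMap.range A : Set E) := hclosed.isComplete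
  have : (LinearMap.range A).HasOrthogonalProjection :=
    haveI : CompleteSpace (LinearMap.range A) := hcomplete.completeSpace_coe
    inferInstance
  -- A vector orthogonal to the range lies in the domain and is killed by `H - i r`, so the lower
  -- bound for `-r` makes it zero.
  have htop : LinearMap.range A = ⊤ := by
    rw [← Submodule.orthogonal_eq_bot_iff, Submodule.eq_bot_iff]
    intro x hx
    have hx' : ∀ u : H.domain, inner ℂ x (H u) + ((r : ℂ) * Complex.I) * inner ℂ x (u : E) = 0 := by
      intro u
      have h1 : inner ℂ (A u) x = 0 := hx (A u) ⟨u, rfl⟩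
      rw [← inner_conj_symm, hA, inner_add_right, inner_smul_right, map_eq_zero] at h1
      exact h1
    obtain ⟨z, hz, hHz⟩ := LinearPMap.exists_domain_of_inner hH
      (x := x) (w := ((r : ℂ) * Complex.I) • x) fun u => by
        rw [inner_smul_left]
        have h1 := hx' u
        simp only [map_mul, Complex.conj_ofReal, Complex.conj_I]
        linear_combination -h1
    have h1 := LinearPMap.abs_mul_norm_le hH (-r) z
    rw [hHz, hz, ← add_smul] at h1
    simp only [Complex.ofReal_neg, neg_mul, add_neg_cancel, zero_smul, norm_zero, abs_neg] at h1
    have h2 : ‖x‖ ≤ 0 := by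
      by_contra! h
      nlinarith [mul_pos hr' h]
    exact norm_le_zero_iff.mp h2
  obtain ⟨v, hv⟩ : w ∈ LinearMap.range A := htop ▸ Submodule.mem_top
  exact ⟨v, hv⟩

theorem LinearPMap.eq_of_apply_add_smul_eq (hH : IsSelfAdjoint H) {r : ℝ} (hr : r ≠ 0)
    {u v : H.domain} (h : H u + ((r : ℂ) * Complex.I) • (u : E) =
      H v + ((r : ℂ) * Complex.I) • (v : E)) : u = v := by
  have h1 := LinearPMap.abs_mul_norm_le hH r (u - v)
  have h2 : H (u - v) + ((r : ℂ) * Complex.I) • ((u - v : H.domain) : E) = 0 := by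
    rw [LinearPMap.map_sub, Submodule.coe_sub, smul_sub, ← sub_eq_zero.mpr h]
    abel
  rw [h2, norm_zero] at h1
  have h3 : ‖((u - v : H.domain) : E)‖ ≤ 0 := by
    by_contra! h
    nlinarith [mul_pos (abs_pos.mpr hr) h]
  have h4 := norm_le_zero_iff.mp h3
  rw [Submodule.coe_sub, sub_eq_zero] at h4
  exact Subtype.ext h4

theorem LinearPMap.exists_resolvent (hH : IsSelfAdjoint H) {r : ℝ} (hr : r ≠ 0) :
    ∃ R : E →L[ℂ] E, ∀ w, ∃ v : H.domain, (v : E) = R w ∧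
      H v + ((r : ℂ) * Complex.I) • (v : E) = w := by
  choose S hS using LinearPMap.exists_apply_add_smul_eq hH hr
  let L : E →ₗ[ℂ] E :=
    { toFun := fun w => (S w : E)
      map_add' := fun a b => by
        rw [← Submodule.coe_add]
        congr 1
        apply LinearPMap.eq_of_apply_add_smul_eq hH hr
        rw [hS, LinearPMap.map_add, Submodule.coe_add, smul_add]
        conv_lhs => rw [← hS a, ← hS b]
        abel
      map_smul' := fun c a => by
        rw [RingHom.id_apply, ← Submodule.coe_smul]
        congr 1
        apply LinearPMap.eq_of_apply_add_smul_eq hH hr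
        rw [hS, LinearPMap.map_smul, Submodule.coe_smul, smul_comm, ← smul_add, hS] }
  refine ⟨L.mkContinuous |r|⁻¹ fun w => ?_, fun w => ⟨S w, rfl, hS w⟩⟩
  have h1 := LinearPMap.abs_mul_norm_le hH r (S w)
  rw [hS] at h1
  rwa [inv_mul_eq_div, le_div_iff₀' (abs_pos.mpr hr)]

open Classical in
/-- The bounded operator `(H + i r)⁻¹` for a self-adjoint `H` and a real `r ≠ 0`. -/
def imagResolvent (H : E →ₗ.[ℂ] E) (r : ℝ) : E →L[ℂ] E :=
  if h : ∃ R : E →L[ℂ] E, ∀ w, ∃ v : H.domain, (v : E) = R w ∧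
      H v + ((r : ℂ) * Complex.I) • (v : E) = w then h.choose else 0

theorem imagResolvent_spec (hH : IsSelfAdjoint H) {r : ℝ} (hr : r ≠ 0) (w : E) :
    ∃ v : H.domain, (v : E) = imagResolvent H r w ∧
      H v + ((r : ℂ) * Complex.I) • (v : E) = w := by
  have h := LinearPMap.exists_resolvent hH hr
  rw [imagResolvent, dif_pos h]
  exact h.choose_spec w

theorem imagResolvent_apply (hH : IsSelfAdjoint H) {r : ℝ} (hr : r ≠ 0) (v : H.domain) :
    imagResolvent H r (H v + ((r : ℂ) * Complex.I) • (v : E)) = v := by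
  obtain ⟨u, hu, hu'⟩ := imagResolvent_spec hH hr (H v + ((r : ℂ) * Complex.I) • (v : E))
  rw [← hu, LinearPMap.eq_of_apply_add_smul_eq hH hr hu']

theorem imagResolvent_domain (hH : IsSelfAdjoint H) {r : ℝ} (hr : r ≠ 0) (v : H.domain) :
    imagResolvent H r (H v) = v - ((r : ℂ) * Complex.I) • imagResolvent H r v := by
  have h := imagResolvent_apply hH hr v
  rw [map_add, map_smul] at h
  exact eq_sub_of_add_eq h

theorem abs_mul_norm_imagResolvent_le (hH : IsSelfAdjoint H) {r : ℝ} (hr : r ≠ 0) (w : E) :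
    |r| * ‖imagResolvent H r w‖ ≤ ‖w‖ := by
  obtain ⟨u, hu, hu'⟩ := imagResolvent_spec hH hr w
  have := LinearPMap.abs_mul_norm_le hH r u
  rwa [hu', hu] at this

theorem inner_imagResolvent_left (hH : IsSelfAdjoint H) {r : ℝ} (hr : r ≠ 0) (x y : E) :
    inner ℂ (imagResolvent H r x) y = inner ℂ x (imagResolvent H (-r) y) := by
  obtain ⟨u, hu, hu'⟩ := imagResolvent_spec hH hr x
  obtain ⟨v, hv, hv'⟩ := imagResolvent_spec hH (neg_ne_zero.mpr hr) y
  rw [← hu, ← hv]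
  conv_lhs => rw [← hv']
  conv_rhs => rw [← hu']
  rw [inner_add_right, inner_add_left, inner_smul_left, inner_smul_right,
    LinearPMap.inner_apply_left hH]
  simp

theorem imagResolvent_sub (hH : IsSelfAdjoint H) {r s : ℝ} (hr : r ≠ 0) (hs : s ≠ 0) (w : E) :
    imagResolvent H r w - imagResolvent H s w =
      (((s - r : ℝ) : ℂ) * Complex.I) • imagResolvent H r (imagResolvent H s w) := by
  obtain ⟨v, hv, hv'⟩ := imagResolvent_spec hH hs w
  have h := imagResolvent_domain hH hr v
  rw [← hv]
  conv_lhs => rw [← hv']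
  rw [map_add, map_smul, h]
  push_cast
  module

theorem imagResolvent_comm (hH : IsSelfAdjoint H) {r s : ℝ} (hr : r ≠ 0) (hs : s ≠ 0) :
    Commute (imagResolvent H r) (imagResolvent H s) := by
  rcases eq_or_ne r s with rfl | hrs
  · exact Commute.refl _
  ext w
  have h1 := imagResolvent_sub hH hr hs w
  have h2 := imagResolvent_sub hH hs hr w
  have h3 : (((s - r : ℝ) : ℂ) * Complex.I) • (imagResolvent H r (imagResolvent H s w) -
      imagResolvent H s (imagResolvent H r w)) = 0 := by
    rw [smul_sub, ← h1]
    have : (((r - s : ℝ) : ℂ) * Complex.I) = -(((s - r : ℝ) : ℂ) * Complex.I) := by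
      push_cast; ring
    rw [this, neg_smul] at h2
    rw [sub_eq_zero, ← neg_inj, ← h2, neg_sub]
  rcases smul_eq_zero.mp h3 with h | h
  · exfalso
    have : (s - r : ℝ) = 0 := by
      have := (mul_eq_zero.mp h).resolve_right Complex.I_ne_zero
      exact_mod_cast this
    exact hrs (sub_eq_zero.mp this).symm
  · exact sub_eq_zero.mp h

/-- The regularization `i r (H + i r)⁻¹` of the identity. -/
def imagResolventReg (H : E →ₗ.[ℂ] E) (r : ℝ) : E →L[ℂ] E :=
  ((r : ℂ) * Complex.I) • imagResolvent H r

theorem norm_imagResolventReg_le (hH : IsSelfAdjoint H) {r : ℝ} (hr : r ≠ 0) (w : E) :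
    ‖imagResolventReg H r w‖ ≤ ‖w‖ := by
  have := abs_mul_norm_imagResolvent_le hH hr w
  simpa [imagResolventReg, norm_smul] using this

theorem imagResolventReg_sub_domain (hH : IsSelfAdjoint H) {r : ℝ} (hr : r ≠ 0) (v : H.domain) :
    ‖imagResolventReg H r v - v‖ ≤ |r|⁻¹ * ‖H v‖ := by
  have h := imagResolvent_domain hH hr v
  have h1 := abs_mul_norm_imagResolvent_le hH hr (H v)
  rw [inv_mul_eq_div, le_div_iff₀' (abs_pos.mpr hr)]
  rw [h, ← norm_neg, neg_sub] at h1
  exact h1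

/-- On the domain the error is at most `|r|⁻¹ ‖H v‖`; density and the uniform bound `‖i r (H + i
r)⁻¹‖ ≤ 1` do the rest. -/
theorem tendsto_imagResolventReg (hH : IsSelfAdjoint H) {r : ℕ → ℝ} (hr : ∀ n, r n ≠ 0)
    (hlim : Tendsto (fun n => |r n|⁻¹) atTop (𝓝 0)) (x : E) :
    Tendsto (fun n => imagResolventReg H (r n) x) atTop (𝓝 x) := by
  rw [Metric.tendsto_nhds]
  intro ε hε
  obtain ⟨v, hv, hxv⟩ := Metric.dense_iff.mp hH.dense_domain x (ε / 3) (by positivity)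
  have hv' : Tendsto (fun n => |r n|⁻¹ * ‖H ⟨v, hxv⟩‖) atTop (𝓝 0) := by
    simpa using hlim.mul_const ‖H ⟨v, hxv⟩‖
  filter_upwards [hv'.eventually_lt_const (show 0 < ε / 3 by positivity)] with n hn
  have h1 := imagResolventReg_sub_domain hH (hr n) ⟨v, hxv⟩
  have h2 := norm_imagResolventReg_le hH (hr n) (x - v)
  rw [Metric.mem_ball, dist_eq_norm] at hv
  rw [norm_sub_rev] at hv
  have h3 : imagResolventReg H (r n) x - x = imagResolventReg H (r n) (x - v) +
      (imagResolventReg H (r n) v - v) + (v - x) := by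
    rw [map_sub]; abel
  rw [dist_eq_norm, h3]
  have h4 := norm_add₃_le (a := imagResolventReg H (r n) (x - v))
    (b := imagResolventReg H (r n) v - v) (c := v - x)
  have h5 : ‖v - x‖ < ε / 3 := by rwa [norm_sub_rev]
  simp only at h1
  linarith

/-- The Yosida approximation of the self-adjoint operator `H`. -/
def yosida (H : E →ₗ.[ℂ] E) (r : ℝ) : E →L[ℂ] E :=
  ((r : ℂ) ^ 2 / 2) • (imagResolvent H r + imagResolvent H (-r))

/-- Averaging over `r` and `-r` keeps the approximation symmetric: formally it is `r² H (H² +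
r²)⁻¹`, and `r² (H² + r²)⁻¹` is the product of the two regularizations. This yields both the bound
by `‖H v‖` and the convergence to `H v`. -/
theorem yosida_domain (hH : IsSelfAdjoint H) {r : ℝ} (hr : r ≠ 0) (v : H.domain) :
    yosida H r v = imagResolventReg H r (imagResolventReg H (-r) (H v)) := by
  have h1 := imagResolvent_domain hH (neg_ne_zero.mpr hr) v
  have h2 := imagResolvent_sub hH hr (neg_ne_zero.mpr hr) (v : E)
  have h3 : imagResolvent H (-r) (v : E) = imagResolvent H r v +
      (2 * (r : ℂ) * Complex.I) • imagResolvent H r (imagResolvent H (-r) v) := by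
    rw [sub_eq_iff_eq_add] at h2
    rw [h2]
    push_cast
    module
  simp only [yosida, imagResolventReg, smul_apply,
    add_apply, map_smul, h1, map_sub, smul_smul]
  conv_lhs => rw [h3]
  rw [smul_sub, smul_smul, smul_add, smul_add, smul_smul]
  push_cast
  have hI : Complex.I * Complex.I = -1 := Complex.I_mul_I
  have e1 : -(r : ℂ) * Complex.I * ((r : ℂ) * Complex.I) = (r : ℂ) ^ 2 := by
    linear_combination -(r : ℂ) ^ 2 * hI
  rw [e1, ← add_assoc, ← add_smul, sub_eq_add_neg, ← neg_smul, smul_smul]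
  congr 2 <;> ring

theorem inner_yosida_left (hH : IsSelfAdjoint H) {r : ℝ} (hr : r ≠ 0) (x y : E) :
    inner ℂ (yosida H r x) y = inner ℂ x (yosida H r y) := by
  have h1 := inner_imagResolvent_left hH hr x y
  have h2 := inner_imagResolvent_left hH (neg_ne_zero.mpr hr) x y
  rw [neg_neg] at h2
  simp only [yosida, smul_apply, add_apply,
    inner_smul_left, inner_smul_right, inner_add_left, inner_add_right, h1, h2]
  simp only [map_div₀, map_pow, Complex.conj_ofReal, Complex.conj_ofNat]
  ring

theorem norm_yosida_domain_le (hH : IsSelfAdjoint H) {r : ℝ} (hr : r ≠ 0) (v : H.domain) :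
    ‖yosida H r v‖ ≤ ‖H v‖ := by
  rw [yosida_domain hH hr]
  exact (norm_imagResolventReg_le hH hr _).trans
    (norm_imagResolventReg_le hH (neg_ne_zero.mpr hr) _)

theorem tendsto_yosida_domain (hH : IsSelfAdjoint H) {r : ℕ → ℝ} (hr : ∀ n, r n ≠ 0)
    (hlim : Tendsto (fun n => |r n|⁻¹) atTop (𝓝 0)) (v : H.domain) :
    Tendsto (fun n => yosida H (r n) v) atTop (𝓝 (H v)) := by
  have h1 := tendsto_imagResolventReg hH hr hlim (H v)
  have h2 := tendsto_imagResolventReg hH (r := fun n => -r n) (fun n => neg_ne_zero.mpr (hr n))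
    (by simpa using hlim) (H v)
  have h3 : Tendsto (fun n => imagResolventReg H (r n)
      (imagResolventReg H (-r n) (H v) - H v)) atTop (𝓝 0) := by
    refine squeeze_zero_norm (fun n => norm_imagResolventReg_le hH (hr n) _) ?_
    simpa using (tendsto_iff_norm_sub_tendsto_zero.mp h2)
  refine (by simpa using h3.add h1 : Tendsto _ _ (𝓝 (H v))).congr fun n => ?_
  rw [yosida_domain hH (hr n)]

theorem yosida_comm_imagResolvent (hH : IsSelfAdjoint H) {r s : ℝ} (hr : r ≠ 0) (hs : s ≠ 0) :
    Commute (yosida H r) (imagResolvent H s) := by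
  refine Commute.smul_left (Commute.add_left ?_ ?_) _
  · exact imagResolvent_comm hH hr hs
  · exact imagResolvent_comm hH (neg_ne_zero.mpr hr) hs

theorem yosida_comm (hH : IsSelfAdjoint H) {r s : ℝ} (hr : r ≠ 0) (hs : s ≠ 0) :
    Commute (yosida H r) (yosida H s) := by
  refine Commute.smul_right (Commute.add_right ?_ ?_) _
  · exact yosida_comm_imagResolvent hH hr hs
  · exact yosida_comm_imagResolvent hH hr (neg_ne_zero.mpr hs)

end SelfAdjointOperator

/-! ### The unitary group generated by `-i H`. -/

section Propagator

variable {E : Type*} [NormedAddCommGroup E] [InnerProductSpace ℂ E] [CompleteSpace E]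
  {H : E →ₗ.[ℂ] E}

/-- The path `exp ((1-s) C) exp (s B) v` joins `exp C v` to `exp B v`; by commutation its velocity
is `exp ((1-s) C) exp (s B) (B v - C v)`, and both exponentials are contractions. -/
theorem norm_exp_sub_exp_apply_le {B C : E →L[ℂ] E} (hBC : Commute B C)
    (hB : ∀ (s : ℝ) (x : E), ‖NormedSpace.exp (s • B) x‖ ≤ ‖x‖)
    (hC : ∀ (s : ℝ) (x : E), ‖NormedSpace.exp (s • C) x‖ ≤ ‖x‖) (v : E) :
    ‖NormedSpace.exp B v - NormedSpace.exp C v‖ ≤ ‖B v - C v‖ := by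
  have hd : ∀ s : ℝ, HasDerivAt
      (fun s : ℝ => NormedSpace.exp ((1 - s) • C) (NormedSpace.exp (s • B) v))
      (NormedSpace.exp ((1 - s) • C) (NormedSpace.exp (s • B) (B v - C v))) s := by
    intro s
    have h1 := hasDerivAt_exp_smul_const (𝕂 := ℝ) B s
    have h2 := (hasDerivAt_exp_smul_const (𝕂 := ℝ) C (1 - s)).scomp s
      ((hasDerivAt_id s).const_sub 1)
    have h3 := (h2.mul h1)
    have h4 := ((ContinuousLinearMap.apply ℂ E v).restrictScalars ℝ).hasFDerivAt.comp_hasDerivAt s h3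
    refine h4.congr_deriv ?_
    have hc : C * NormedSpace.exp (s • B) = NormedSpace.exp (s • B) * C :=
      ((hBC.symm.smul_right s).exp_right).eq
    have hc' := DFunLike.congr_fun hc v
    simp only [mul_apply_eq_comp] at hc'
    simp [hc']
    abel
  have := norm_image_sub_le_of_norm_deriv_le_segment_01'
    (fun s _ => (hd s).hasDerivWithinAt) (C := ‖B v - C v‖)
    (fun s _ => (hC _ _).trans (hB _ _))
  simpa using this

/-- The unitary group `exp (-i t H_r)` of the Yosida approximation `H_r`. -/
def yosidaGroup (H : E →ₗ.[ℂ] E) (r t : ℝ) : E →L[ℂ] E :=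
  NormedSpace.exp (t • (-(Complex.I • yosida H r)))

theorem inner_yosidaGroup_left (hH : IsSelfAdjoint H) {r : ℝ} (hr : r ≠ 0) (t : ℝ) (x y : E) :
    inner ℂ (yosidaGroup H r t x) y = inner ℂ x (yosidaGroup H r (-t) y) := by
  have hs : star (yosida H r) = yosida H r := by
    rw [ContinuousLinearMap.star_eq_adjoint]
    exact ((ContinuousLinearMap.eq_adjoint_iff _ _).mpr (inner_yosida_left hH hr)).symm
  have h : star (yosidaGroup H r t) = yosidaGroup H r (-t) := by
    rw [yosidaGroup, yosidaGroup, NormedSpace.star_exp, star_smul, star_neg, star_smul, hs]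
    simp
  rw [← h, ContinuousLinearMap.star_eq_adjoint, ContinuousLinearMap.adjoint_inner_right]

theorem yosidaGroup_add (r s t : ℝ) :
    yosidaGroup H r (s + t) = yosidaGroup H r s * yosidaGroup H r t := by
  let +nondep : NormedAlgebra ℚ (E →L[ℂ] E) := .restrictScalars ℚ ℂ (E →L[ℂ] E)
  rw [yosidaGroup, add_smul, NormedSpace.exp_add_of_commute]
  · rfl
  · exact ((Commute.refl _).smul_left _).smul_right _

theorem yosidaGroup_zero (r : ℝ) : yosidaGroup H r 0 = 1 := by
  simp [yosidaGroup]

theorem norm_yosidaGroup (hH : IsSelfAdjoint H) {r : ℝ} (hr : r ≠ 0) (t : ℝ) (x : E) :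
    ‖yosidaGroup H r t x‖ = ‖x‖ := by
  have h : inner ℂ (yosidaGroup H r t x) (yosidaGroup H r t x) = inner ℂ x x := by
    rw [inner_yosidaGroup_left hH hr, ← mul_apply_eq_comp, ← yosidaGroup_add,
      neg_add_cancel, yosidaGroup_zero, one_apply_eq_self]
  rw [norm_eq_sqrt_re_inner (𝕜 := ℂ), h, ← norm_eq_sqrt_re_inner]

theorem yosidaGroup_sub_le (hH : IsSelfAdjoint H) {r s : ℝ} (hr : r ≠ 0) (hs : s ≠ 0) (t : ℝ)
    (v : E) : ‖yosidaGroup H r t v - yosidaGroup H s t v‖ ≤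
      |t| * ‖yosida H r v - yosida H s v‖ := by
  refine (norm_exp_sub_exp_apply_le ?_ ?_ ?_ v).trans_eq ?_
  · exact ((((yosida_comm hH hr hs).smul_left _).smul_right _).neg_left.neg_right.smul_left
      _).smul_right _
  · intro u x
    rw [smul_smul]
    exact (norm_yosidaGroup hH hr _ x).le
  · intro u x
    rw [smul_smul]
    exact (norm_yosidaGroup hH hs _ x).le
  · simp only [smul_apply, neg_apply, ← smul_sub, neg_sub_neg, norm_smul]
    rw [norm_sub_rev]
    simp

theorem yosidaGroup_sub_time_le (hH : IsSelfAdjoint H) {r : ℝ} (hr : r ≠ 0) (s t : ℝ)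
    (v : E) : ‖yosidaGroup H r t v - yosidaGroup H r s v‖ ≤ |t - s| * ‖yosida H r v‖ := by
  refine (norm_exp_sub_exp_apply_le ?_ ?_ ?_ v).trans_eq ?_
  · exact ((Commute.refl _).smul_left _).smul_right _
  · intro u x
    rw [smul_smul]
    exact (norm_yosidaGroup hH hr _ x).le
  · intro u x
    rw [smul_smul]
    exact (norm_yosidaGroup hH hr _ x).le
  · simp only [smul_apply, ← sub_smul, norm_smul, neg_apply, norm_neg]
    simp

theorem hasDerivAt_yosidaGroup (r t : ℝ) (v : E) :
    HasDerivAt (fun s => yosidaGroup H r s v)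
      (-(Complex.I • yosida H r (yosidaGroup H r t v))) t := by
  have h1 := hasDerivAt_exp_smul_const' (𝕂 := ℝ) (-(Complex.I • yosida H r)) t
  have h2 := ((ContinuousLinearMap.apply ℂ E v).restrictScalars ℝ).hasFDerivAt.comp_hasDerivAt t h1
  refine h2.congr_deriv ?_
  simp [yosidaGroup]

theorem yosidaGroup_comm {r : ℝ} {A : E →L[ℂ] E} (h : Commute (yosida H r) A) (t : ℝ) :
    Commute (yosidaGroup H r t) A :=
  (((h.symm.smul_right Complex.I).neg_right.smul_right t).exp_right).symm

/-- `U t = exp (-i t H)`, as the limit of the unitary groups of the Yosida approximations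
`yosida H (n + 1)`. -/
structure IsPropagator (H : E →ₗ.[ℂ] E) (U : ℝ → E →L[ℂ] E) : Prop where
  zero : U 0 = 1
  norm_apply : ∀ t x, ‖U t x‖ = ‖x‖
  inner_left : ∀ t x y, inner ℂ (U t x) y = inner ℂ x (U (-t) y)
  continuous : ∀ x, Continuous fun t => U t x
  tendsto : ∀ t x, Tendsto (fun n : ℕ => yosidaGroup H (n + 1) t x) atTop (𝓝 (U t x))

theorem tendsto_abs_natCast_add_one_inv :
    Tendsto (fun n : ℕ => |((n : ℝ) + 1)|⁻¹) atTop (𝓝 0) := by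
  refine (tendsto_one_div_add_atTop_nhds_zero_nat (𝕜 := ℝ)).congr fun n => ?_
  rw [abs_of_pos (by positivity), one_div]

/-- For `v` in the domain, two approximating groups differ by at most `|t|` times the difference of
the generators at `v`, so they converge there. Being isometric, they converge everywhere by density,
and the algebraic identities pass to the limit. -/
theorem exists_isPropagator (hH : IsSelfAdjoint H) :
    ∃ U : ℝ → E →L[ℂ] E, IsPropagator H U := by
  have hr : ∀ n : ℕ, ((n : ℝ) + 1) ≠ 0 := fun n => by positivity
  have hlim := tendsto_abs_natCast_add_one_inv
  have hcauchy : ∀ t x, CauchySeq fun n : ℕ => yosidaGroup H (n + 1) t x := by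
    intro t x
    rw [Metric.cauchySeq_iff]
    intro ε hε
    obtain ⟨v, hv, hxv⟩ := Metric.dense_iff.mp hH.dense_domain x (ε / 3) (by positivity)
    obtain ⟨N, hN⟩ := Metric.cauchySeq_iff.mp
      (tendsto_yosida_domain hH hr hlim ⟨v, hxv⟩).cauchySeq (ε / 3 / (|t| + 1)) (by positivity)
    refine ⟨N, fun m hm n hn => ?_⟩
    have h1 := yosidaGroup_sub_le hH (hr m) (hr n) t v
    have h2 : |t| * ‖yosida H (m + 1) v - yosida H (n + 1) v‖ ≤ ε / 3 := by
      have h3 := hN m hm n hn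
      rw [dist_eq_norm, lt_div_iff₀ (by positivity)] at h3
      simp only at h3
      nlinarith [norm_nonneg (yosida H (m + 1) v - yosida H (n + 1) v)]
    have h4 : yosidaGroup H (m + 1) t x - yosidaGroup H (n + 1) t x =
        yosidaGroup H (m + 1) t (x - v) + (yosidaGroup H (m + 1) t v - yosidaGroup H (n + 1) t v) +
          yosidaGroup H (n + 1) t (v - x) := by
      simp only [map_sub]; abel
    have h5 := norm_add₃_le (a := yosidaGroup H (m + 1) t (x - v))
      (b := yosidaGroup H (m + 1) t v - yosidaGroup H (n + 1) t v)
      (c := yosidaGroup H (n + 1) t (v - x))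
    rw [norm_yosidaGroup hH (hr m), norm_yosidaGroup hH (hr n), norm_sub_rev x v] at h5
    rw [Metric.mem_ball, dist_eq_norm] at hv
    rw [dist_eq_norm, h4]
    linarith
  choose f hf using fun t x => cauchySeq_tendsto_of_complete (hcauchy t x)
  have hf' : ∀ t, Tendsto (fun (n : ℕ) (x : E) => yosidaGroup H (n + 1) t x) atTop (𝓝 (f t)) :=
    fun t => tendsto_pi_nhds.mpr (hf t)
  let U : ℝ → E →L[ℂ] E := fun t => continuousLinearMapOfTendsto
    (fun n : ℕ => yosidaGroup H (n + 1) t) (hf' t)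
  have hU : ∀ t x, Tendsto (fun n : ℕ => yosidaGroup H (n + 1) t x) atTop (𝓝 (U t x)) := hf
  have hnorm : ∀ t x, ‖U t x‖ = ‖x‖ := fun t x => by
    refine tendsto_nhds_unique (hU t x).norm ?_
    simp only [norm_yosidaGroup hH (hr _)]
    exact tendsto_const_nhds
  refine ⟨U, ?_, hnorm, ?_, ?_, hU⟩
  · ext x
    refine tendsto_nhds_unique (hU 0 x) ?_
    simp only [yosidaGroup_zero]
    exact tendsto_const_nhds
  · intro t x y
    refine tendsto_nhds_unique ((hU t x).inner tendsto_const_nhds) ?_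
    simp only [inner_yosidaGroup_left hH (hr _)]
    exact tendsto_const_nhds.inner (hU (-t) y)
  · intro x
    rw [Metric.continuous_iff]
    intro s ε hε
    obtain ⟨v, hv, hxv⟩ := Metric.dense_iff.mp hH.dense_domain x (ε / 3) (by positivity)
    refine ⟨ε / 3 / (‖H ⟨v, hxv⟩‖ + 1), by positivity, fun t ht => ?_⟩
    have h1 : ‖U t v - U s v‖ ≤ |t - s| * ‖H ⟨v, hxv⟩‖ := by
      refine le_of_tendsto ((hU t v).sub (hU s v)).norm (Eventually.of_forall fun n => ?_)
      refine (yosidaGroup_sub_time_le hH (hr n) s t v).trans ?_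
      gcongr
      exact norm_yosida_domain_le hH (hr n) ⟨v, hxv⟩
    rw [Real.dist_eq, lt_div_iff₀ (by positivity)] at ht
    have h4 : U t x - U s x = U t (x - v) + (U t v - U s v) + U s (v - x) := by
      simp only [map_sub]; abel
    have h5 := norm_add₃_le (a := U t (x - v)) (b := U t v - U s v) (c := U s (v - x))
    rw [hnorm, hnorm, norm_sub_rev x v] at h5
    rw [Metric.mem_ball, dist_eq_norm] at hv
    rw [dist_eq_norm, h4]
    nlinarith [abs_nonneg (t - s)]

theorem IsPropagator.continuous_uncurry {U : ℝ → E →L[ℂ] E} (hU : IsPropagator H U) :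
    Continuous fun p : ℝ × E => U p.1 p.2 := by
  refine continuous_prod_of_continuous_lipschitzWith' (fun p : ℝ × E => U p.1 p.2) 1 (fun t => ?_)
    hU.continuous
  refine LipschitzWith.of_dist_le_mul fun x y => ?_
  simp only [NNReal.coe_one, one_mul, dist_eq_norm, ← map_sub, hU.norm_apply, le_refl]

end Propagator

/-! ### Absolute continuity and the product rule for inner products. -/

section ProductRule

variable {E : Type*} [NormedAddCommGroup E] [InnerProductSpace ℂ E]

theorem AbsolutelyContinuousOnInterval.of_dist_le {X Y : Type*} [PseudoMetricSpace X]
    [PseudoMetricSpace Y] {f : ℝ → X} {g : ℝ → Y} {a b : ℝ}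
    (hg : AbsolutelyContinuousOnInterval g a b)
    (h : ∀ x ∈ uIcc a b, ∀ y ∈ uIcc a b, dist (f x) (f y) ≤ dist (g x) (g y)) :
    AbsolutelyContinuousOnInterval f a b := by
  rw [absolutelyContinuousOnInterval_iff] at hg ⊢
  intro ε hε
  obtain ⟨δ, hδ, H⟩ := hg ε hε
  refine ⟨δ, hδ, fun E hE hE' => (Finset.sum_le_sum fun i hi => ?_).trans_lt (H E hE hE')⟩
  exact h _ (hE.1 i hi).1 _ (hE.1 i hi).2

theorem AbsolutelyContinuousOnInterval.inner {f g : ℝ → E} {a b : ℝ}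
    (hf : AbsolutelyContinuousOnInterval f a b) (hg : AbsolutelyContinuousOnInterval g a b) :
    AbsolutelyContinuousOnInterval (fun t => inner ℂ (f t) (g t)) a b := by
  obtain ⟨C, hC⟩ := hf.exists_bound
  obtain ⟨D, hD⟩ := hg.exists_bound
  unfold AbsolutelyContinuousOnInterval at hf hg ⊢
  apply squeeze_zero' ?_ ?_
    (by simpa using (hg.const_mul C).add (hf.const_mul D))
  · exact Eventually.of_forall fun _ => Finset.sum_nonneg fun i hi => dist_nonneg
  rw [eventually_inf_principal]
  filter_upwards with (n, I) hnI
  simp only [Finset.mul_sum, ← Finset.sum_add_distrib]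
  gcongr with i hi
  have h1 := hC _ (hnI.1 i hi).1
  have h2 := hD _ (hnI.1 i hi).2
  have h3 : (Inner.inner ℂ (f (I i).1) (g (I i).1) : ℂ) - Inner.inner ℂ (f (I i).2) (g (I i).2) =
      Inner.inner ℂ (f (I i).1) (g (I i).1 - g (I i).2) +
        Inner.inner ℂ (f (I i).1 - f (I i).2) (g (I i).2) := by
    rw [inner_sub_left, inner_sub_right]; ring
  rw [dist_eq_norm, dist_eq_norm, dist_eq_norm, h3]
  refine (norm_add_le _ _).trans (add_le_add ?_ ?_)
  · exact (norm_inner_le_norm _ _).trans (by gcongr)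
  · rw [mul_comm]
    exact (norm_inner_le_norm _ _).trans (by gcongr)

theorem IntervalIntegrable.absolutelyContinuousOnInterval_integral {f : ℝ → E}
    {a b : ℝ} (h : IntervalIntegrable f volume a b) :
    AbsolutelyContinuousOnInterval (fun x => ∫ v in a..x, f v) a b := by
  have hsub : ∀ x ∈ uIcc a b, IntervalIntegrable f volume a x := fun x hx =>
    h.mono_set (uIcc_subset_uIcc left_mem_uIcc hx)
  refine (h.norm.absolutelyContinuousOnInterval_intervalIntegral
    (c := a) left_mem_uIcc).of_dist_le fun x hx y hy => ?_
  rw [dist_eq_norm, Real.dist_eq, intervalIntegral.integral_interval_sub_left (hsub x hx)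
    (hsub y hy), intervalIntegral.integral_interval_sub_left (hsub x hx).norm (hsub y hy).norm]
  exact intervalIntegral.norm_integral_le_abs_integral_norm

theorem IntervalIntegrable.inner_continuousOn {f g : ℝ → E} {a b : ℝ}
    (hf : IntervalIntegrable f volume a b) (hg : ContinuousOn g (uIcc a b)) :
    IntervalIntegrable (fun s => inner ℂ (f s) (g s)) volume a b := by
  obtain ⟨C, hC⟩ := isCompact_uIcc.exists_bound_of_continuousOn hg
  rw [intervalIntegrable_iff] at hf ⊢
  have hm : AEStronglyMeasurable g (volume.restrict (uIoc a b)) :=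
    (hg.mono uIoc_subset_uIcc).aestronglyMeasurable measurableSet_uIoc
  refine (hf.norm.const_mul C).mono' (hf.aestronglyMeasurable.inner hm) ?_
  filter_upwards [ae_restrict_mem measurableSet_uIoc] with s hs
  rw [mul_comm]
  exact (norm_inner_le_norm _ _).trans (by gcongr; exact hC s (uIoc_subset_uIcc hs))

theorem IntervalIntegrable.continuousOn_inner {f g : ℝ → E} {a b : ℝ}
    (hf : ContinuousOn f (uIcc a b)) (hg : IntervalIntegrable g volume a b) :
    IntervalIntegrable (fun s => inner ℂ (f s) (g s)) volume a b := by
  have h := hg.inner_continuousOn hf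
  rw [intervalIntegrable_iff] at h ⊢
  refine (integrable_norm_iff ?_).mp (h.norm.congr ?_)
  · have hm : AEStronglyMeasurable f (volume.restrict (uIoc a b)) :=
      (hf.mono uIoc_subset_uIcc).aestronglyMeasurable measurableSet_uIoc
    exact hm.inner (intervalIntegrable_iff.mp hg).aestronglyMeasurable
  · exact Eventually.of_forall fun s => norm_inner_symm _ _

/-- Product rule for the inner product of two indefinite integrals of integrable functions. -/
theorem inner_sub_inner_eq_integral [CompleteSpace E] {f g f' g' : ℝ → E} {a b : ℝ}
    (hf' : IntervalIntegrable f' volume a b) (hg' : IntervalIntegrable g' volume a b)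
    (hf : ∀ t ∈ uIcc a b, f t - f a = ∫ s in a..t, f' s)
    (hg : ∀ t ∈ uIcc a b, g t - g a = ∫ s in a..t, g' s) :
    (inner ℂ (f b) (g b) : ℂ) - inner ℂ (f a) (g a) =
      ∫ s in a..b, (inner ℂ (f s) (g' s) + inner ℂ (f' s) (g s)) := by
  -- Nothing is known of `f` and `g` outside the interval, so differentiation is done on indefinite
  -- integrals defined on the whole line.
  let F : ℝ → E := fun t => f a + ∫ s in a..t, f' s
  let G : ℝ → E := fun t => g a + ∫ s in a..t, g' s
  have hF : ∀ t ∈ uIcc a b, f t = F t := fun t ht => by simp [F, ← hf t ht]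
  have hG : ∀ t ∈ uIcc a b, g t = G t := fun t ht => by simp [G, ← hg t ht]
  have hFac : AbsolutelyContinuousOnInterval F a b :=
    hf'.absolutelyContinuousOnInterval_integral.of_dist_le fun x _ y _ => by simp [F]
  have hGac : AbsolutelyContinuousOnInterval G a b :=
    hg'.absolutelyContinuousOnInterval_integral.of_dist_le fun x _ y _ => by simp [G]
  have hint : IntervalIntegrable (fun s => inner ℂ (F s) (g' s) + inner ℂ (f' s) (G s))
      volume a b :=
    (IntervalIntegrable.continuousOn_inner hFac.continuousOn hg').add
      (hf'.inner_continuousOn hGac.continuousOn)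
  have hac := (hFac.inner hGac).sub hint.absolutelyContinuousOnInterval_integral
  -- An absolutely continuous function with zero derivative almost everywhere is constant.
  obtain ⟨C, hC⟩ := hac.const_of_ae_hasDerivAt_zero (by
    filter_upwards [hf'.ae_hasDerivAt_integral, hg'.ae_hasDerivAt_integral,
      hint.ae_hasDerivAt_integral] with x h1 h2 h3 hx
    have h4 := ((h1 hx a left_mem_uIcc).const_add (f a)).inner ℂ
      ((h2 hx a left_mem_uIcc).const_add (g a))
    exact (h4.sub (h3 hx a left_mem_uIcc)).congr_deriv (sub_self _))
  have ha := hC a left_mem_uIcc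
  have hb := hC b right_mem_uIcc
  rw [← ha] at hb
  simp only [Pi.sub_apply, intervalIntegral.integral_same, sub_zero] at hb
  rw [hF b right_mem_uIcc, hG b right_mem_uIcc, hF a left_mem_uIcc, hG a left_mem_uIcc, ← hb,
    sub_sub_cancel]
  refine intervalIntegral.integral_congr fun s hs => ?_
  simp only [hF s hs, hG s hs]

end ProductRule

/-! ### Integrability of controls. -/

section ControlSpace

variable {E : Type*} [NormedAddCommGroup E] [NormedSpace ℂ E] {T : ℝ}

theorem ControlSpace.intervalIntegrable (e : ControlSpace T) {a b : ℝ} (ha : a ∈ Icc 0 T)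
    (hb : b ∈ Icc 0 T) : IntervalIntegrable e volume a b := by
  have h : IntegrableOn e (Icc 0 T) volume := (Lp.memLp e).integrable one_le_two
  exact (h.mono_set (uIcc_subset_Icc ha hb)).intervalIntegrable

theorem ControlSpace.intervalIntegrable_smul (e : ControlSpace T) {g : ℝ → E}
    (hg : ContinuousOn g (Icc 0 T)) {a b : ℝ} (ha : a ∈ Icc 0 T) (hb : b ∈ Icc 0 T) :
    IntervalIntegrable (fun s => ((e s : ℝ) : ℂ) • g s) volume a b := by
  have hg' := hg.mono (uIcc_subset_Icc ha hb)
  exact ((e.intervalIntegrable ha hb).smul_continuousOn hg').congr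
    (fun s hs => by simp [Complex.coe_smul])

end ControlSpace

/-! ### From the weak equation to a strong equation for the resolvent of a solution. -/

section Solution

variable {E : Type*} [NormedAddCommGroup E] [InnerProductSpace ℂ E]
  {H : E →ₗ.[ℂ] E} {μ : E →L[ℂ] E} {T : ℝ} {e : ControlSpace T} {t₀ : ℝ} {φ₀ : E} {φ : ℝ → E}

theorem IsSchrodingerSolution.inner_sub (h : IsSchrodingerSolution H μ e t₀ φ₀ φ)
    (ht₀ : t₀ ∈ Icc 0 T) (v : H.domain) {a b : ℝ} (ha : a ∈ Icc 0 T) (hb : b ∈ Icc 0 T) :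
    (inner ℂ (v : E) (φ b) : ℂ) - inner ℂ (v : E) (φ a) = -Complex.I * ∫ s in a..b,
        (inner ℂ (H v) (φ s) - ((e s : ℝ) : ℂ) * inner ℂ (v : E) (μ (φ s))) := by
  have hint : ∀ c ∈ Icc 0 T, IntervalIntegrable (fun s =>
      inner ℂ (H v) (φ s) - ((e s : ℝ) : ℂ) * inner ℂ (v : E) (μ (φ s))) volume t₀ c := by
    intro c hc
    have h1 : ContinuousOn (fun s => (inner ℂ (H v) (φ s) : ℂ)) (uIcc t₀ c) :=
      (continuousOn_const.inner h.continuousOn).mono (uIcc_subset_Icc ht₀ hc)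
    have h2 : ContinuousOn (fun s => (inner ℂ (v : E) (μ (φ s)) : ℂ)) (Icc 0 T) :=
      continuousOn_const.inner (μ.continuous.comp_continuousOn h.continuousOn)
    exact h1.intervalIntegrable.sub (e.intervalIntegrable_smul h2 ht₀ hc)
  rw [h.equation v b hb, h.equation v a ha, sub_sub_sub_cancel_left, ← mul_sub,
    ← neg_sub (∫ s in t₀..b, _), intervalIntegral.integral_interval_sub_left (hint b hb)
    (hint a ha)]
  ring

/-- The integrand of the integral equation satisfied by `(H + i r)⁻¹ φ`. -/
def resolventVelocity [CompleteSpace E] (H : E →ₗ.[ℂ] E) (μ : E →L[ℂ] E) (e : ControlSpace T) (φ : ℝ → E)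
    (r s : ℝ) : E :=
  -(Complex.I • (φ s - ((r : ℂ) * Complex.I) • imagResolvent H r (φ s) -
    ((e s : ℝ) : ℂ) • imagResolvent H r (μ (φ s))))

theorem IsSchrodingerSolution.intervalIntegrable_resolventVelocity [CompleteSpace E]
    (h : IsSchrodingerSolution H μ e t₀ φ₀ φ) (r : ℝ) {a b : ℝ} (ha : a ∈ Icc 0 T)
    (hb : b ∈ Icc 0 T) :
    IntervalIntegrable (resolventVelocity H μ e φ r) volume a b := by
  have hc := h.continuousOn
  have h1 : ContinuousOn (fun s => φ s - ((r : ℂ) * Complex.I) • imagResolvent H r (φ s))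
    (uIcc a b) := by
    refine ContinuousOn.mono ?_ (uIcc_subset_Icc ha hb)
    fun_prop
  have h2 : ContinuousOn (fun s => imagResolvent H r (μ (φ s))) (Icc 0 T) := by
    fun_prop
  exact ((h1.intervalIntegrable.sub (e.intervalIntegrable_smul h2 ha hb)).smul Complex.I).neg

/-- For any `w`, the vector `(H - i r)⁻¹ w` is an admissible test vector; moving the resolvent to
the other side of the inner product leaves an identity tested against arbitrary `w`. -/
theorem IsSchrodingerSolution.imagResolvent_sub [CompleteSpace E] (hH : IsSelfAdjoint H)
    (h : IsSchrodingerSolution H μ e t₀ φ₀ φ) (ht₀ : t₀ ∈ Icc 0 T) {r : ℝ} (hr : r ≠ 0)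
    {a b : ℝ} (ha : a ∈ Icc 0 T) (hb : b ∈ Icc 0 T) :
    imagResolvent H r (φ b) - imagResolvent H r (φ a) =
      ∫ s in a..b, resolventVelocity H μ e φ r s := by
  refine ext_inner_left ℂ fun w => ?_
  obtain ⟨v, hv, hv'⟩ := imagResolvent_spec hH (neg_ne_zero.mpr hr) w
  have hadj : ∀ x, (inner ℂ w (imagResolvent H r x) : ℂ) = inner ℂ (v : E) x := by
    intro x
    rw [hv, inner_imagResolvent_left hH (neg_ne_zero.mpr hr), neg_neg]
  have hcomm := (innerSL ℂ w).intervalIntegral_comp_comm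
    (h.intervalIntegrable_resolventVelocity r ha hb)
  simp only [innerSL_apply_apply] at hcomm
  rw [← hcomm, inner_sub_right, hadj, hadj, h.inner_sub ht₀ v ha hb,
    ← intervalIntegral.integral_const_mul]
  refine intervalIntegral.integral_congr fun s _ => ?_
  have hHv : H v = w - (((-r : ℝ) : ℂ) * Complex.I) • (v : E) := eq_sub_of_add_eq hv'
  simp only [resolventVelocity, inner_neg_right, inner_smul_right, inner_sub_right, hadj, hHv,
    inner_sub_left, inner_smul_left, map_mul, Complex.conj_ofReal, Complex.conj_I]
  push_cast
  ring

end Solution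

/-! ### Conservation of the norm and Duhamel's formula. -/

section SolutionFormula

variable {E : Type*} [NormedAddCommGroup E] [InnerProductSpace ℂ E] [CompleteSpace E]
  {H : E →ₗ.[ℂ] E} {μ : E →L[ℂ] E} {T : ℝ} {e : ControlSpace T} {t₀ : ℝ} {φ₀ : E} {φ : ℝ → E}

/-- The product rule applies to the regularized solution. Since `u = (H + i r)⁻¹ φ` is in the domain
and `⟨u, H u⟩` is real, `H` contributes nothing and only the control term remains. -/
theorem IsSchrodingerSolution.inner_imagResolventReg_sub (hH : IsSelfAdjoint H)
    (h : IsSchrodingerSolution H μ e t₀ φ₀ φ) (ht₀ : t₀ ∈ Icc 0 T) {r : ℝ} (hr : r ≠ 0)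
    {a b : ℝ} (ha : a ∈ Icc 0 T) (hb : b ∈ Icc 0 T) :
    (inner ℂ (imagResolventReg H r (φ b)) (imagResolventReg H r (φ b)) : ℂ) -
      inner ℂ (imagResolventReg H r (φ a)) (imagResolventReg H r (φ a)) =
      ∫ s in a..b, ((2 * (e s * (Complex.I * inner ℂ (imagResolventReg H r (φ s))
        (imagResolventReg H r (μ (φ s)))).re) : ℝ) : ℂ) := by
  have hv := h.intervalIntegrable_resolventVelocity r ha hb
  have hd : ∀ t ∈ uIcc a b, imagResolventReg H r (φ t) - imagResolventReg H r (φ a) =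
      ∫ s in a..t, ((r : ℂ) * Complex.I) • resolventVelocity H μ e φ r s := by
    intro t ht
    rw [intervalIntegral.integral_smul, ← h.imagResolvent_sub hH ht₀ hr ha
      (uIcc_subset_Icc ha hb ht)]
    simp [imagResolventReg, smul_sub]
  rw [inner_sub_inner_eq_integral (hv.smul _) (hv.smul _) hd hd]
  refine intervalIntegral.integral_congr fun s _ => ?_
  obtain ⟨u, hu, hu'⟩ := imagResolvent_spec hH hr (φ s)
  have hreal : (inner ℂ (u : E) (H u) : ℂ).im = 0 := by
    rw [← Complex.conj_eq_iff_im, inner_conj_symm, LinearPMap.inner_apply_left hH]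
  have key : (inner ℂ (imagResolventReg H r (φ s))
      (((r : ℂ) * Complex.I) • resolventVelocity H μ e φ r s) : ℂ).re =
      e s * (Complex.I * inner ℂ (imagResolventReg H r (φ s))
        (imagResolventReg H r (μ (φ s)))).re := by
    have hz : resolventVelocity H μ e φ r s = -(Complex.I • (H u - ((e s : ℝ) : ℂ) •
        imagResolvent H r (μ (φ s)))) := by
      rw [resolventVelocity, ← hu, ← eq_sub_of_add_eq hu']
    rw [hz]
    simp only [imagResolventReg, smul_apply, ← hu, inner_smul_left, inner_smul_right,
      inner_neg_right, inner_sub_right, map_mul, Complex.conj_ofReal, Complex.conj_I,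
      Complex.mul_re, Complex.mul_im, Complex.sub_re, Complex.sub_im, Complex.neg_re,
      Complex.neg_im, Complex.ofReal_re, Complex.ofReal_im, Complex.I_re, Complex.I_im, hreal]
    ring
  simp only [Pi.smul_apply]
  rw [← inner_conj_symm (((r : ℂ) * Complex.I) • resolventVelocity H μ e φ r s),
    Complex.add_conj, key]

/-- The norm of a solution of the Schrödinger equation is conserved. -/
theorem IsSchrodingerSolution.norm_eq (hH : IsSelfAdjoint H) (hμ : IsSelfAdjoint μ)
    (h : IsSchrodingerSolution H μ e t₀ φ₀ φ) (ht₀ : t₀ ∈ Icc 0 T)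
    {b : ℝ} (hb : b ∈ Icc 0 T) : ‖φ b‖ = ‖φ₀‖ := by
  obtain ⟨C, hC⟩ := isCompact_Icc.exists_bound_of_continuousOn h.continuousOn
  have hC0 : 0 ≤ C := (norm_nonneg _).trans (hC b hb)
  have hr : ∀ n : ℕ, ((n : ℝ) + 1) ≠ 0 := fun n => by positivity
  have hJ : ∀ x, Tendsto (fun n : ℕ => imagResolventReg H (n + 1) x) atTop (𝓝 x) :=
    tendsto_imagResolventReg hH hr tendsto_abs_natCast_add_one_inv
  have hsub : uIoc t₀ b ⊆ Icc 0 T := uIoc_subset_uIcc.trans (uIcc_subset_Icc ht₀ hb)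
  -- The regularizations are contractions converging strongly to the identity, so the control term
  -- tends to the integral of `2 e Re (i ⟨φ, μ φ⟩)`, which vanishes because `μ` is symmetric.
  have hlim := intervalIntegral.tendsto_integral_filter_of_dominated_convergence
    (a := t₀) (b := b) (μ := volume) (l := atTop)
    (F := fun (n : ℕ) s => ((2 * (e s * (Complex.I * inner ℂ (imagResolventReg H (n + 1) (φ s))
        (imagResolventReg H (n + 1) (μ (φ s)))).re) : ℝ) : ℂ))
    (f := fun s => ((2 * (e s * (Complex.I * inner ℂ (φ s) (μ (φ s))).re) : ℝ) : ℂ))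
    (fun s => 2 * (‖e s‖ * (C * (‖μ‖ * C)))) (Eventually.of_forall fun n => by
      have hm := (intervalIntegrable_iff.mp (e.intervalIntegrable ht₀ hb)).aestronglyMeasurable
      have hc : ContinuousOn (fun s => (Complex.I * inner ℂ (imagResolventReg H (n + 1) (φ s))
        (imagResolventReg H (n + 1) (μ (φ s)))).re) (uIoc t₀ b) := by
        have := h.continuousOn.mono hsub
        fun_prop
      exact Complex.continuous_ofReal.comp_aestronglyMeasurable
        ((hm.mul (hc.aestronglyMeasurable measurableSet_uIoc)).const_mul 2))
    (Eventually.of_forall fun n => Eventually.of_forall fun s hs => by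
      rw [Complex.norm_real, norm_mul, norm_mul, Real.norm_two]
      gcongr
      refine (Complex.abs_re_le_norm _).trans ?_
      rw [norm_mul, Complex.norm_I, one_mul]
      refine (norm_inner_le_norm _ _).trans ?_
      gcongr
      · exact (norm_imagResolventReg_le hH (hr n) _).trans (hC s (hsub hs))
      · refine (norm_imagResolventReg_le hH (hr n) _).trans ((μ.le_opNorm _).trans ?_)
        gcongr
        exact hC s (hsub hs))
    (((e.intervalIntegrable ht₀ hb).norm.mul_const _).const_mul 2)
    (Eventually.of_forall fun s hs => by
      have h1 := (hJ (φ s)).inner (𝕜 := ℂ) (hJ (μ (φ s)))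
      have h2 := (Complex.continuous_re.tendsto _).comp (h1.const_mul Complex.I)
      exact (Complex.continuous_ofReal.tendsto _).comp ((h2.const_mul (e s)).const_mul 2))
  have hzero : ∀ s, (Complex.I * inner ℂ (φ s) (μ (φ s))).re = 0 := by
    intro s
    have him : (inner ℂ (φ s) (μ (φ s)) : ℂ).im = 0 := by
      rw [← Complex.conj_eq_iff_im, inner_conj_symm]
      exact (ContinuousLinearMap.isSelfAdjoint_iff_isSymmetric.mp hμ) (φ s) (φ s)
    simp [him]
  simp only [hzero, mul_zero, Complex.ofReal_zero, intervalIntegral.integral_zero] at hlim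
  have hlim2 := ((hJ (φ b)).inner (𝕜 := ℂ) (hJ (φ b))).sub ((hJ (φ t₀)).inner (𝕜 := ℂ) (hJ (φ t₀)))
  have h0 := tendsto_nhds_unique (hlim2.congr fun n =>
    h.inner_imagResolventReg_sub hH ht₀ (hr n) ht₀ hb) (by exact_mod_cast hlim)
  rw [sub_eq_zero] at h0
  rw [← h.initial, norm_eq_sqrt_re_inner (𝕜 := ℂ), h0, ← norm_eq_sqrt_re_inner]

/-- This is Duhamel's formula for the approximate group, with the error from replacing `H` by its
approximation. With `w = (H - i) v`, the product rule applies to the group acting on `w` paired with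
`(H + i)⁻¹ φ`; the resolvent commutes with the group and turns `w` back into `v`. -/
theorem IsSchrodingerSolution.inner_yosidaGroup_sub (hH : IsSelfAdjoint H)
    (h : IsSchrodingerSolution H μ e t₀ φ₀ φ) (ht₀ : t₀ ∈ Icc 0 T) {r : ℝ} (hr : r ≠ 0)
    {a b : ℝ} (ha : a ∈ Icc 0 T) (hb : b ∈ Icc 0 T) (v : H.domain) :
    (inner ℂ (v : E) (φ b) : ℂ) - inner ℂ (yosidaGroup H r (a - b) v) (φ a) =
      ∫ s in a..b, (Complex.I * inner ℂ (yosidaGroup H r (s - b) (yosida H r v - H v)) (φ s) +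
        Complex.I * (((e s : ℝ) : ℂ) * inner ℂ (yosidaGroup H r (s - b) v) (μ (φ s)))) := by
  set w : E := H v + (((-1 : ℝ) : ℂ) * Complex.I) • (v : E) with hw
  have hR : imagResolvent H (-1) w = v := imagResolvent_apply hH (by norm_num) v
  have hderiv : ∀ s, HasDerivAt (fun s => yosidaGroup H r (s - b) w)
      (-(Complex.I • yosida H r (yosidaGroup H r (s - b) w))) s := fun s =>
    (hasDerivAt_yosidaGroup r (s - b) w).comp_sub_const s b
  have hcont : Continuous fun s => yosidaGroup H r (s - b) w :=
    continuous_iff_continuousAt.mpr fun s => (hderiv s).continuousAt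
  have hcont' : Continuous fun s => -(Complex.I • yosida H r (yosidaGroup H r (s - b) w)) := by
    fun_prop
  have hcommY : ∀ s x, imagResolvent H (-1) (yosidaGroup H r s x) =
      yosidaGroup H r s (imagResolvent H (-1) x) := fun s x =>
    (DFunLike.congr_fun (yosidaGroup_comm
      (yosida_comm_imagResolvent hH hr (show (-1 : ℝ) ≠ 0 by norm_num)) s).eq x).symm
  have hcommH : ∀ x, imagResolvent H (-1) (yosida H r x) = yosida H r (imagResolvent H (-1) x) :=
    fun x => (DFunLike.congr_fun
      (yosida_comm_imagResolvent hH hr (show (-1 : ℝ) ≠ 0 by norm_num)).eq x).symm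
  have hcommHY : ∀ s x, yosida H r (yosidaGroup H r s x) = yosidaGroup H r s (yosida H r x) :=
    fun s x => (DFunLike.congr_fun (yosidaGroup_comm (Commute.refl (yosida H r)) s).eq x).symm
  have hadj : ∀ s x, (inner ℂ (yosidaGroup H r s w) (imagResolvent H 1 x) : ℂ) =
      inner ℂ (yosidaGroup H r s v) x := by
    intro s x
    rw [← hR, ← hcommY, inner_imagResolvent_left hH (by norm_num), neg_neg]
  have hprod := inner_sub_inner_eq_integral (hcont'.intervalIntegrable a b)
    (h.intervalIntegrable_resolventVelocity 1 ha hb)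
    (fun t _ => (intervalIntegral.integral_eq_sub_of_hasDerivAt (fun s _ => hderiv s)
      (hcont'.intervalIntegrable a t)).symm)
    (fun t ht => h.imagResolvent_sub hH ht₀ one_ne_zero ha (uIcc_subset_Icc ha hb ht))
  rw [hadj, hadj, sub_self, yosidaGroup_zero, one_apply_eq_self] at hprod
  rw [hprod]
  refine intervalIntegral.integral_congr fun s _ => ?_
  have h1 : (inner ℂ (yosida H r (yosidaGroup H r (s - b) w)) (imagResolvent H 1 (φ s)) : ℂ) =
      inner ℂ (yosidaGroup H r (s - b) (yosida H r v)) (φ s) := by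
    rw [← neg_neg (1 : ℝ), ← inner_imagResolvent_left hH (by norm_num), hcommH, hcommY, hR, hcommHY]
  have h2 : yosidaGroup H r (s - b) w = yosidaGroup H r (s - b) (H v) +
      (((-1 : ℝ) : ℂ) * Complex.I) • yosidaGroup H r (s - b) v := by
    rw [hw, map_add, map_smul]
  simp only [resolventVelocity, inner_neg_right, inner_neg_left, inner_smul_left, inner_smul_right,
    inner_sub_right, hadj, h1, map_sub, inner_sub_left, Complex.conj_I]
  rw [h2, inner_add_left, inner_smul_left]
  simp only [map_mul, Complex.conj_ofReal, Complex.conj_I]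
  push_cast
  ring

theorem IsSchrodingerSolution.continuousOn_propagator {U : ℝ → E →L[ℂ] E} (hU : IsPropagator H U)
    (h : IsSchrodingerSolution H μ e t₀ φ₀ φ) (b : ℝ) :
    ContinuousOn (fun s => U (b - s) (μ (φ s))) (Icc 0 T) := by
  have h1 : ContinuousOn (fun s => (b - s, μ (φ s))) (Icc 0 T) := by
    have := h.continuousOn
    fun_prop
  exact hU.continuous_uncurry.comp_continuousOn h1

/-- Duhamel's formula. -/
theorem IsSchrodingerSolution.sub_propagator_eq_integral {U : ℝ → E →L[ℂ] E}
    (hU : IsPropagator H U) (hH : IsSelfAdjoint H)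
    (h : IsSchrodingerSolution H μ e t₀ φ₀ φ) (ht₀ : t₀ ∈ Icc 0 T)
    {a b : ℝ} (ha : a ∈ Icc 0 T) (hb : b ∈ Icc 0 T) :
    φ b - U (b - a) (φ a) =
      ∫ s in a..b, ((e s : ℝ) : ℂ) • (Complex.I • U (b - s) (μ (φ s))) := by
  refine hH.dense_domain.eq_of_inner_right ℂ fun v hv => ?_
  have hadj : ∀ s x, (inner ℂ v (U (b - s) x) : ℂ) = inner ℂ (U (s - b) v) x := by
    intro s x
    rw [hU.inner_left, neg_sub]
  have hcont : ContinuousOn (fun s => Complex.I • U (b - s) (μ (φ s))) (Icc 0 T) :=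
    (h.continuousOn_propagator hU b).const_smul Complex.I
  have hcomm := (innerSL ℂ v).intervalIntegral_comp_comm
    (e.intervalIntegrable_smul hcont ha hb)
  simp only [innerSL_apply_apply] at hcomm
  rw [← hcomm, inner_sub_right, hadj]
  obtain ⟨C, hC⟩ := isCompact_Icc.exists_bound_of_continuousOn h.continuousOn
  have hC0 : 0 ≤ C := (norm_nonneg _).trans (hC b hb)
  have hr : ∀ n : ℕ, ((n : ℝ) + 1) ≠ 0 := fun n => by positivity
  have hY : Tendsto (fun n : ℕ => yosida H (n + 1) v) atTop (𝓝 (H ⟨v, hv⟩)) :=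
    tendsto_yosida_domain hH hr tendsto_abs_natCast_add_one_inv ⟨v, hv⟩
  have hsub : uIoc a b ⊆ Icc 0 T := uIoc_subset_uIcc.trans (uIcc_subset_Icc ha hb)
  -- The error term vanishes in the limit because the approximate groups are isometric and `yosida H
  -- (n + 1) v` tends to `H v`.
  have hlim := intervalIntegral.tendsto_integral_filter_of_dominated_convergence
    (a := a) (b := b) (μ := volume) (l := atTop)
    (F := fun (n : ℕ) s => Complex.I * inner ℂ (yosidaGroup H (n + 1) (s - b)
        (yosida H (n + 1) v - H ⟨v, hv⟩)) (φ s) +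
        Complex.I * (((e s : ℝ) : ℂ) * inner ℂ (yosidaGroup H (n + 1) (s - b) v) (μ (φ s))))
    (f := fun s => inner ℂ v (((e s : ℝ) : ℂ) • (Complex.I • U (b - s) (μ (φ s)))))
    (fun s => (2 * ‖H ⟨v, hv⟩‖) * C + ‖e s‖ * (‖v‖ * (‖μ‖ * C)))
    (Eventually.of_forall fun n => by
      have hm := (intervalIntegrable_iff.mp (e.intervalIntegrable ha hb)).aestronglyMeasurable
      have hφ := h.continuousOn.mono hsub
      have hg : ∀ x, ContinuousOn (fun s => yosidaGroup H (n + 1) (s - b) x) (uIoc a b) :=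
        fun x => Continuous.continuousOn (continuous_iff_continuousAt.mpr fun s =>
          ((hasDerivAt_yosidaGroup _ _ _).comp_sub_const s b).continuousAt)
      have h1 := ((hg (yosida H (n + 1) v - H ⟨v, hv⟩)).inner (𝕜 := ℂ) hφ).aestronglyMeasurable
        (μ := volume) measurableSet_uIoc
      have h2 := ((hg v).inner (𝕜 := ℂ) (μ.continuous.comp_continuousOn hφ)).aestronglyMeasurable
        (μ := volume) measurableSet_uIoc
      exact (h1.const_mul _).add
        (((Complex.continuous_ofReal.comp_aestronglyMeasurable hm).mul h2).const_mul _))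
    (Eventually.of_forall fun n => Eventually.of_forall fun s hs => by
      refine (norm_add_le _ _).trans (add_le_add ?_ ?_)
      · rw [norm_mul, Complex.norm_I, one_mul]
        refine (norm_inner_le_norm _ _).trans ?_
        rw [norm_yosidaGroup hH (hr n)]
        gcongr
        · refine (norm_sub_le _ _).trans ?_
          have := norm_yosida_domain_le hH (hr n) ⟨v, hv⟩
          simp only at this
          linarith
        · exact hC s (hsub hs)
      · rw [norm_mul, norm_mul, Complex.norm_I, one_mul, Complex.norm_real]
        gcongr
        refine (norm_inner_le_norm _ _).trans ?_
        rw [norm_yosidaGroup hH (hr n)]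
        gcongr
        refine (μ.le_opNorm _).trans ?_
        gcongr
        exact hC s (hsub hs))
    (intervalIntegrable_const.add ((e.intervalIntegrable ha hb).norm.mul_const _))
    (Eventually.of_forall fun s hs => by
      have h0 : Tendsto (fun n : ℕ => yosidaGroup H (n + 1) (s - b)
          (yosida H (n + 1) v - H ⟨v, hv⟩)) atTop (𝓝 0) := by
        rw [tendsto_zero_iff_norm_tendsto_zero]
        simp only [norm_yosidaGroup hH (hr _)]
        exact tendsto_iff_norm_sub_tendsto_zero.mp hY
      have h1 := ((h0.inner (𝕜 := ℂ) (tendsto_const_nhds (x := φ s))).const_mul Complex.I).add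
        ((((hU.tendsto (s - b) v).inner (𝕜 := ℂ) (tendsto_const_nhds (x := μ (φ s)))).const_mul
          ((e s : ℝ) : ℂ)).const_mul Complex.I)
      refine (h1.congr fun n => rfl).trans_eq ?_
      rw [inner_zero_left, mul_zero, zero_add, inner_smul_right, inner_smul_right, hadj]
      congr 1
      ring)
  refine tendsto_nhds_unique ?_ hlim
  refine (((hU.tendsto (a - b) v).inner (𝕜 := ℂ)
    (tendsto_const_nhds (x := φ a))).const_sub (inner ℂ v (φ b))).congr fun n => ?_
  exact h.inner_yosidaGroup_sub hH ht₀ (hr n) ha hb ⟨v, hv⟩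

end SolutionFormula

/-! ### Total boundedness through finite-dimensional subspaces. -/

section Approximation

theorem totallyBounded_of_approx {X : Type*} [PseudoMetricSpace X] {S : Set X}
    (h : ∀ ε > 0, ∃ C : Set X, TotallyBounded C ∧ ∀ x ∈ S, ∃ c ∈ C, dist x c ≤ ε) :
    TotallyBounded S := by
  rw [Metric.totallyBounded_iff]
  intro ε hε
  obtain ⟨C, hC, hSC⟩ := h (ε / 3) (by positivity)
  obtain ⟨t, ht, hCt⟩ := Metric.totallyBounded_iff.mp hC (ε / 3) (by positivity)
  refine ⟨t, ht, fun x hx => ?_⟩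
  obtain ⟨c, hc, hxc⟩ := hSC x hx
  obtain ⟨y, hy, hcy⟩ := mem_iUnion₂.mp (hCt hc)
  refine mem_iUnion₂.mpr ⟨y, hy, ?_⟩
  rw [Metric.mem_ball] at hcy ⊢
  linarith [dist_triangle x c y]

variable {E : Type*} [NormedAddCommGroup E] [InnerProductSpace ℂ E]

/-- The span of the centres of a finite cover by balls of radius `ε` works. -/
theorem IsCompact.exists_finiteDimensional_approx {C : Set E} (hC : IsCompact C) {ε : ℝ}
    (hε : 0 < ε) : ∃ (V : Submodule ℂ E) (_ : FiniteDimensional ℂ V),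
      ∀ x ∈ C, ‖Vᗮ.starProjection x‖ ≤ ε := by
  obtain ⟨t, -, ht, hCt⟩ := _root_.finite_cover_balls_of_compact hC hε
  have hfin : FiniteDimensional ℂ (Submodule.span ℂ t) := FiniteDimensional.span_of_finite ℂ ht
  refine ⟨Submodule.span ℂ t, hfin, fun x hx => ?_⟩
  obtain ⟨y, hy, hxy⟩ := mem_iUnion₂.mp (hCt hx)
  have hy0 : (Submodule.span ℂ t)ᗮ.starProjection y = 0 := by
    rw [Submodule.starProjection_orthogonal_val, sub_eq_zero]
    exact (Submodule.starProjection_eq_self_iff.mpr (Submodule.subset_span hy)).symm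
  rw [← sub_zero ((Submodule.span ℂ t)ᗮ.starProjection x), ← hy0, ← map_sub]
  refine (Submodule.norm_starProjection_apply_le _ _).trans ?_
  rw [← dist_eq_norm]
  exact (Metric.mem_ball.mp hxy).le

theorem Submodule.isCompact_inter_closedBall (V : Submodule ℂ E) [FiniteDimensional ℂ V] (B : ℝ) :
    IsCompact ((V : Set E) ∩ Metric.closedBall 0 B) := by
  have : ProperSpace V := FiniteDimensional.proper ℂ V
  have h := (isCompact_closedBall (0 : V) B).image continuous_subtype_val
  convert h using 1
  ext x
  constructor
  · rintro ⟨hx, hx'⟩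
    exact ⟨⟨x, hx⟩, by simpa using hx', rfl⟩
  · rintro ⟨v, hv, rfl⟩
    exact ⟨v.2, by simpa using hv⟩

theorem totallyBounded_of_finiteDimensional_approx {S : Set E} {B : ℝ}
    (hB : ∀ x ∈ S, ‖x‖ ≤ B)
    (h : ∀ ε > 0, ∃ (V : Submodule ℂ E) (_ : FiniteDimensional ℂ V),
      ∀ x ∈ S, ‖Vᗮ.starProjection x‖ ≤ ε) : TotallyBounded S := by
  refine totallyBounded_of_approx fun ε hε => ?_
  obtain ⟨V, hV, hSV⟩ := h ε hε
  refine ⟨_, (V.isCompact_inter_closedBall B).totallyBounded, fun x hx =>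
    ⟨V.starProjection x, ⟨V.starProjection_apply_mem x, ?_⟩, ?_⟩⟩
  · rw [mem_closedBall_zero_iff]
    exact (V.norm_starProjection_apply_le x).trans (hB x hx)
  · rw [dist_eq_norm, ← Submodule.starProjection_orthogonal_val]
    exact hSV x hx

end Approximation

/-! ### Exponentially weighted integrals of `L²` controls. -/

section ControlEstimates

variable {T : ℝ}

theorem ControlSpace.integrableOn_sq (e : ControlSpace T) :
    IntegrableOn (fun s => e s ^ 2) (Icc 0 T) volume :=
  (Lp.memLp e).integrable_sq

theorem ControlSpace.integral_sq (e : ControlSpace T) :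
    ∫ s in Icc 0 T, e s ^ 2 = ‖e‖ ^ 2 := by
  rw [← real_inner_self_eq_norm_sq, L2.inner_def]
  simp [sq]

theorem setIntegral_exp_mul_abs_sub_le {c : ℝ} (hc : 0 < c) (a b : ℝ) :
    ∫ s in uIoc a b, Real.exp (c * |s - a|) ≤ Real.exp (c * |b - a|) / c := by
  rcases le_total a b with hab | hab
  · rw [uIoc_of_le hab, ← intervalIntegral.integral_of_le hab]
    have h1 : ∫ s in a..b, Real.exp (c * |s - a|) = ∫ s in a..b, Real.exp (c * (s - a)) := by
      refine intervalIntegral.integral_congr fun s hs => ?_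
      rw [uIcc_of_le hab] at hs
      simp only [abs_of_nonneg (sub_nonneg.mpr hs.1)]
    have h2 : ∀ s ∈ uIcc a b, HasDerivAt (fun s => Real.exp (c * (s - a)) / c)
        (Real.exp (c * (s - a))) s := fun s _ => by
      have := ((((hasDerivAt_id s).sub_const a).const_mul c).exp).div_const c
      refine this.congr_deriv ?_
      simp only [id]
      field_simp
    rw [h1, intervalIntegral.integral_eq_sub_of_hasDerivAt h2
      (Continuous.intervalIntegrable (by fun_prop) _ _), abs_of_nonneg (sub_nonneg.mpr hab)]
    have : 0 < Real.exp (c * (a - a)) / c := by positivity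
    linarith
  · rw [uIoc_of_ge hab, ← intervalIntegral.integral_of_le hab]
    have h1 : ∫ s in b..a, Real.exp (c * |s - a|) = ∫ s in b..a, Real.exp (c * (a - s)) := by
      refine intervalIntegral.integral_congr fun s hs => ?_
      rw [uIcc_of_le hab] at hs
      simp only [abs_of_nonpos (sub_nonpos.mpr hs.2), neg_sub]
    have h2 : ∀ s ∈ uIcc b a, HasDerivAt (fun s => -(Real.exp (c * (a - s)) / c))
        (Real.exp (c * (a - s))) s := fun s _ => by
      have := (((((hasDerivAt_id s).const_sub a).const_mul c).exp).div_const c).neg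
      refine this.congr_deriv ?_
      simp only [id]
      field_simp
    rw [h1, intervalIntegral.integral_eq_sub_of_hasDerivAt h2
      (Continuous.intervalIntegrable (by fun_prop) _ _), abs_of_nonpos (sub_nonpos.mpr hab), neg_sub]
    have : 0 < Real.exp (c * (a - a)) / c := by positivity
    linarith

/-- Young's inequality for the integral of a control against a continuous weight. -/
theorem ControlSpace.integral_norm_mul_le (e : ControlSpace T) {M κ : ℝ} (hM : ‖e‖ ≤ M)
    (hκ : 0 < κ) {w : ℝ → ℝ} (hw : Continuous w) {a b : ℝ} (ha : a ∈ Icc 0 T) (hb : b ∈ Icc 0 T) :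
    ∫ s in uIoc a b, ‖e s‖ * w s ≤ (κ * M ^ 2 + (∫ s in uIoc a b, w s ^ 2) / κ) / 2 := by
  have hsub : uIoc a b ⊆ Icc 0 T := uIoc_subset_uIcc.trans (uIcc_subset_Icc ha hb)
  have h1 := e.integrableOn_sq.mono_set hsub
  have h2 : IntegrableOn (fun s => w s ^ 2) (uIoc a b) volume :=
    intervalIntegrable_iff.mp ((hw.pow 2).intervalIntegrable a b)
  have h3 : ∫ s in uIoc a b, e s ^ 2 ≤ M ^ 2 := by
    refine (setIntegral_mono_set e.integrableOn_sq (Eventually.of_forall fun s => sq_nonneg _)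
      hsub.eventuallyLE).trans ?_
    rw [e.integral_sq]
    gcongr
  have h4 : ∫ s in uIoc a b, ‖e s‖ * w s ≤
      ∫ s in uIoc a b, (κ / 2 * e s ^ 2 + 1 / (2 * κ) * w s ^ 2) := by
    refine integral_mono ?_ ((h1.const_mul _).add (h2.const_mul _)) fun s => ?_
    · exact intervalIntegrable_iff.mp
        ((e.intervalIntegrable ha hb).norm.mul_continuousOn hw.continuousOn)
    · have h5 : 0 ≤ (κ * ‖e s‖ - w s) ^ 2 / (2 * κ) := by positivity
      have h6 : κ / 2 * e s ^ 2 + 1 / (2 * κ) * w s ^ 2 - ‖e s‖ * w s =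
          (κ * ‖e s‖ - w s) ^ 2 / (2 * κ) := by
        rw [← sq_abs (e s), ← Real.norm_eq_abs]
        field_simp
        ring
      simp only
      linarith
  rw [integral_add (h1.const_mul _) (h2.const_mul _), integral_const_mul, integral_const_mul] at h4
  refine h4.trans ?_
  have : κ / 2 * ∫ s in uIoc a b, e s ^ 2 ≤ κ / 2 * M ^ 2 := by gcongr
  have h7 : 1 / (2 * κ) * ∫ s in uIoc a b, w s ^ 2 = (∫ s in uIoc a b, w s ^ 2) / κ / 2 := by
    field_simp
  rw [h7]
  linarith

/-- A steep weight concentrates near `b`, and the `L²` bound forbids the controls to do so; hence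
`σ` can be as small as desired, uniformly over the ball of radius `M`. This replaces a Gronwall
argument. -/
theorem exists_exponential_weight (M : ℝ) {σ : ℝ} (hσ : 0 < σ) :
    ∃ c > 0, ∀ T : ℝ, ∀ e : ControlSpace T, ‖e‖ ≤ M → ∀ a ∈ Icc 0 T, ∀ b ∈ Icc 0 T,
      ∫ s in uIoc a b, ‖e s‖ * Real.exp (c * |s - a|) ≤ σ * Real.exp (c * |b - a|) := by
  set κ : ℝ := σ / (M ^ 2 + 1) with hκdef
  have hκ : 0 < κ := by positivity
  refine ⟨1 / (2 * κ * σ), by positivity, fun T e hM a ha b hb => ?_⟩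
  set c : ℝ := 1 / (2 * κ * σ) with hcdef
  have hc : 0 < c := by positivity
  set W := Real.exp (c * |b - a|) with hW
  have hWpos : 0 < W := Real.exp_pos _
  -- Young's parameter is scaled by the final weight `W`. Then `κ M² ≤ σ` and `1 / (2 c) = κ σ` make
  -- each of the two averaged terms at most `σ W`.
  refine (e.integral_norm_mul_le hM (κ := κ * W) (by positivity)
    (w := fun s => Real.exp (c * |s - a|)) (by fun_prop) ha hb).trans ?_
  have h1 : ∫ s in uIoc a b, Real.exp (c * |s - a|) ^ 2 ≤ W ^ 2 / (2 * c) := by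
    have h2 := setIntegral_exp_mul_abs_sub_le (c := 2 * c) (by positivity) a b
    have h3 : ∀ x : ℝ, Real.exp (2 * c * x) = Real.exp (c * x) ^ 2 := fun x => by
      rw [← Real.exp_nat_mul]; push_cast; ring_nf
    simpa only [h3] using h2
  have h4 : (∫ s in uIoc a b, Real.exp (c * |s - a|) ^ 2) / (κ * W) ≤ W * σ := by
    rw [div_le_iff₀ (by positivity)]
    refine h1.trans_eq ?_
    rw [hcdef]
    field_simp
  have h5 : κ * M ^ 2 ≤ σ := by
    rw [hκdef, div_mul_eq_mul_div, div_le_iff₀ (by positivity)]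
    nlinarith
  have h6 : κ * W * M ^ 2 ≤ W * σ := by nlinarith
  linarith

end ControlEstimates

/-! ### Compactness of values and equicontinuity of solutions. -/

section SolutionCompactness

variable {E : Type*} [NormedAddCommGroup E] [InnerProductSpace ℂ E] [CompleteSpace E]
  {H : E →ₗ.[ℂ] E} {μ : E →L[ℂ] E} {T t₀ : ℝ} {ι : Type*} {e : ι → ControlSpace T} {φ₀ : ι → E}
  {φ : ι → ℝ → E}

/-- One step of the approximation of the values of the solutions by finite-dimensional spaces:
Duhamel's formula improves the quality of the approximation by a constant factor. -/
theorem IsSchrodingerSolution.exists_finiteDimensional_approx_succ {U : ℝ → E →L[ℂ] E}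
    (hU : IsPropagator H U) (hH : IsSelfAdjoint H) (ht₀ : t₀ ∈ Icc 0 T)
    (h : ∀ i, IsSchrodingerSolution H μ (e i) t₀ (φ₀ i) (φ i))
    {K : Set E} (hK : IsCompact K) (hφ₀ : ∀ i, φ₀ i ∈ K) {B : ℝ}
    (hB : ∀ i, ∀ t ∈ Icc 0 T, ‖φ i t‖ ≤ B) {c σ : ℝ} (hc : 0 < c)
    (hσμ : σ * ‖μ‖ ≤ 1 / 2) (hσ : 0 < σ)
    (hcσ : ∀ i, ∀ t ∈ Icc 0 T, ∫ s in uIoc t₀ t, ‖e i s‖ * Real.exp (c * |s - t₀|) ≤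
      σ * Real.exp (c * |t - t₀|)) {r : ℝ} (hr : 0 < r)
    (V : Submodule ℂ E) [FiniteDimensional ℂ V]
    (hV : ∀ i, ∀ t ∈ Icc 0 T, ‖Vᗮ.starProjection (φ i t)‖ ≤ r * Real.exp (c * |t - t₀|)) :
    ∃ (V' : Submodule ℂ E) (_ : FiniteDimensional ℂ V'), ∀ i, ∀ t ∈ Icc 0 T,
      ‖V'ᗮ.starProjection (φ i t)‖ ≤ 3 / 4 * r * Real.exp (c * |t - t₀|) := by
  -- The compact parts cost `ε` for the initial value and `ε σ` for the integral, in total `r / 4`;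
  -- the part orthogonal to `V` costs at most `σ ‖μ‖ r ≤ r / 2`.
  set ε : ℝ := r / (4 * (1 + σ)) with hε
  have hεpos : 0 < ε := by positivity
  -- `V` has finite dimension, so the bounded `V`-components stay in a compact set after `μ` and the
  -- free evolution.
  have hC₁ : IsCompact ((fun p : ℝ × E => U p.1 (μ p.2)) ''
      (Icc (-T) T ×ˢ ((V : Set E) ∩ Metric.closedBall 0 B))) :=
    (isCompact_Icc.prod (V.isCompact_inter_closedBall B)).image
      (hU.continuous_uncurry.comp (continuous_fst.prodMk (μ.continuous.comp continuous_snd)))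
  have hC₂ : IsCompact ((fun p : ℝ × E => U p.1 p.2) '' (Icc (-T) T ×ˢ K)) :=
    (isCompact_Icc.prod hK).image hU.continuous_uncurry
  obtain ⟨V', hV'fin, hV'⟩ := (hC₁.union hC₂).exists_finiteDimensional_approx hεpos
  refine ⟨V', hV'fin, fun i t ht => ?_⟩
  have hdiff : ∀ s ∈ Icc 0 T, t - s ∈ Icc (-T) T := fun s hs =>
    ⟨by linarith [hs.2, ht.1], by linarith [hs.1, ht.2]⟩
  have hduhamel := (h i).sub_propagator_eq_integral hU hH ht₀ ht₀ ht
  rw [sub_eq_iff_eq_add, (h i).initial] at hduhamel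
  have hcont : ContinuousOn (fun s => Complex.I • U (t - s) (μ (φ i s))) (Icc 0 T) :=
    ((h i).continuousOn_propagator hU t).const_smul Complex.I
  have hcomm := V'ᗮ.starProjection.intervalIntegral_comp_comm
    ((e i).intervalIntegrable_smul hcont ht₀ ht)
  have hsub : uIoc t₀ t ⊆ Icc 0 T := uIoc_subset_uIcc.trans (uIcc_subset_Icc ht₀ ht)
  have hpoint : ∀ s ∈ uIoc t₀ t,
      ‖V'ᗮ.starProjection (((e i s : ℝ) : ℂ) • (Complex.I • U (t - s) (μ (φ i s))))‖ ≤
        (ε + ‖μ‖ * r) * (‖e i s‖ * Real.exp (c * |s - t₀|)) := by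
    intro s hs
    have hs' := hsub hs
    rw [map_smul, map_smul, norm_smul, norm_smul, Complex.norm_I, one_mul, Complex.norm_real]
    have h1 : φ i s = V.starProjection (φ i s) + Vᗮ.starProjection (φ i s) :=
      (Submodule.starProjection_add_starProjection_orthogonal _).symm
    have h2 : ‖V'ᗮ.starProjection (U (t - s) (μ (V.starProjection (φ i s))))‖ ≤ ε := by
      refine hV' _ (Or.inl ⟨(t - s, V.starProjection (φ i s)), ⟨hdiff s hs',
        V.starProjection_apply_mem _, ?_⟩, rfl⟩)
      rw [mem_closedBall_zero_iff]
      exact (V.norm_starProjection_apply_le _).trans (hB i s hs')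
    have h3 : ‖V'ᗮ.starProjection (U (t - s) (μ (Vᗮ.starProjection (φ i s))))‖ ≤
        ‖μ‖ * (r * Real.exp (c * |s - t₀|)) := by
      refine (Submodule.norm_starProjection_apply_le _ _).trans ?_
      rw [hU.norm_apply]
      refine (μ.le_opNorm _).trans ?_
      gcongr
      exact hV i s hs'
    have h4 : 1 ≤ Real.exp (c * |s - t₀|) := Real.one_le_exp (by positivity)
    have h5 : ‖V'ᗮ.starProjection (U (t - s) (μ (φ i s)))‖ ≤
        (ε + ‖μ‖ * r) * Real.exp (c * |s - t₀|) := by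
      rw [h1, map_add, map_add, map_add]
      refine (norm_add_le _ _).trans ?_
      nlinarith
    calc _ ≤ ‖e i s‖ * ((ε + ‖μ‖ * r) * Real.exp (c * |s - t₀|)) := by gcongr
      _ = _ := by ring
  have hint : IntegrableOn (fun s => (ε + ‖μ‖ * r) * (‖e i s‖ * Real.exp (c * |s - t₀|)))
      (uIoc t₀ t) volume := by
    refine Integrable.const_mul (intervalIntegrable_iff.mp
      (((e i).intervalIntegrable ht₀ ht).norm.mul_continuousOn ?_)) _
    fun_prop
  have hmain : ‖V'ᗮ.starProjection (∫ s in t₀..t,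
      ((e i s : ℝ) : ℂ) • (Complex.I • U (t - s) (μ (φ i s))))‖ ≤
      (ε + ‖μ‖ * r) * (σ * Real.exp (c * |t - t₀|)) := by
    rw [← hcomm]
    refine intervalIntegral.norm_integral_le_integral_norm_uIoc.trans ?_
    refine (setIntegral_mono_on ?_ hint measurableSet_uIoc hpoint).trans ?_
    · exact (V'ᗮ.starProjection.integrable_comp (intervalIntegrable_iff.mp
        ((e i).intervalIntegrable_smul hcont ht₀ ht))).norm
    · rw [integral_const_mul]
      gcongr
      exact hcσ i t ht
  have hinit : ‖V'ᗮ.starProjection (U (t - t₀) (φ₀ i))‖ ≤ ε :=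
    hV' _ (Or.inr ⟨(t - t₀, φ₀ i), ⟨hdiff t₀ ht₀, hφ₀ i⟩, rfl⟩)
  rw [hduhamel, map_add]
  refine (norm_add_le _ _).trans ?_
  set W := Real.exp (c * |t - t₀|)
  have hW : 1 ≤ W := Real.one_le_exp (by positivity)
  have hεr : ε * (1 + σ) = r / 4 := by rw [hε]; field_simp
  calc _ ≤ (ε + ‖μ‖ * r) * (σ * W) + ε * W := by
        refine add_le_add hmain (hinit.trans ?_)
        nlinarith
    _ = ε * (1 + σ) * W + σ * ‖μ‖ * (r * W) := by ring
    _ ≤ r / 4 * W + 1 / 2 * (r * W) := by rw [hεr]; gcongr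
    _ = 3 / 4 * r * W := by ring

/-- The values of the solutions of Schrödinger equations with controls bounded in `L²` and initial
values in a compact set are contained in a compact set. -/
theorem IsSchrodingerSolution.exists_isCompact_values {U : ℝ → E →L[ℂ] E}
    (hU : IsPropagator H U) (hH : IsSelfAdjoint H) (ht₀ : t₀ ∈ Icc 0 T)
    (h : ∀ i, IsSchrodingerSolution H μ (e i) t₀ (φ₀ i) (φ i))
    {K : Set E} (hK : IsCompact K) (hφ₀ : ∀ i, φ₀ i ∈ K) {B : ℝ}
    (hB : ∀ i, ∀ t ∈ Icc 0 T, ‖φ i t‖ ≤ B) {M : ℝ} (hM : ∀ i, ‖e i‖ ≤ M) :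
    ∃ C : Set E, IsCompact C ∧ ∀ i, ∀ t ∈ Icc 0 T, φ i t ∈ C := by
  set σ : ℝ := 1 / (2 * (‖μ‖ + 1)) with hσ
  have hσpos : 0 < σ := by positivity
  have hσμ : σ * ‖μ‖ ≤ 1 / 2 := by
    rw [hσ, div_mul_eq_mul_div, div_le_div_iff₀ (by positivity) (by positivity)]
    linarith
  obtain ⟨c, hc, hcσ⟩ := exists_exponential_weight M hσpos
  -- The iteration needs a positive initial radius, even when `B` is zero.
  set B' : ℝ := |B| + 1
  have hstep : ∀ n : ℕ, ∃ (V : Submodule ℂ E) (_ : FiniteDimensional ℂ V), ∀ i, ∀ t ∈ Icc 0 T,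
      ‖Vᗮ.starProjection (φ i t)‖ ≤ (3 / 4) ^ n * B' * Real.exp (c * |t - t₀|) := by
    intro n
    induction n with
    | zero =>
      refine ⟨⊥, inferInstance, fun i t ht => ?_⟩
      refine (Submodule.norm_starProjection_apply_le _ _).trans ?_
      have h1 := (hB i t ht).trans (le_abs_self B)
      have h2 : 1 ≤ Real.exp (c * |t - t₀|) := Real.one_le_exp (by positivity)
      have h3 : 0 < B' := by positivity
      rw [pow_zero, one_mul]
      nlinarith
    | succ n ih =>
      obtain ⟨V, hVfin, hV⟩ := ih
      obtain ⟨V', hV'fin, hV'⟩ := exists_finiteDimensional_approx_succ hU hH ht₀ h hK hφ₀ hB hc hσμ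
        hσpos (fun i t ht => hcσ T (e i) (hM i) t₀ ht₀ t ht) (by positivity) V hV
      refine ⟨V', hV'fin, fun i t ht => (hV' i t ht).trans_eq ?_⟩
      rw [pow_succ]
      ring
  have htb : TotallyBounded {x | ∃ i, ∃ t ∈ Icc 0 T, φ i t = x} := by
    refine totallyBounded_of_finiteDimensional_approx (B := B) ?_ fun ε hε => ?_
    · rintro x ⟨i, t, ht, rfl⟩
      exact hB i t ht
    · have hlim : Tendsto (fun n : ℕ => (3 / 4 : ℝ) ^ n * (B' * Real.exp (c * T))) atTop (𝓝 0) := by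
        simpa using (tendsto_pow_atTop_nhds_zero_of_lt_one (r := (3 / 4 : ℝ)) (by norm_num)
          (by norm_num)).mul_const (B' * Real.exp (c * T))
      obtain ⟨n, hn⟩ := (hlim.eventually_lt_const hε).exists
      obtain ⟨V, hVfin, hV⟩ := hstep n
      refine ⟨V, hVfin, ?_⟩
      rintro x ⟨i, t, ht, rfl⟩
      refine (hV i t ht).trans (le_trans ?_ hn.le)
      rw [mul_assoc]
      have : |t - t₀| ≤ T := abs_sub_le_iff.mpr
        ⟨by linarith [ht.2, ht₀.1], by linarith [ht.1, ht₀.2]⟩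
      gcongr
  exact ⟨closure _, htb.closure.isCompact_of_isClosed isClosed_closure,
    fun i t ht => subset_closure ⟨i, t, ht, rfl⟩⟩

/-- Solutions of Schrödinger equations with controls bounded in `L²` and values in a compact set
are uniformly equicontinuous. -/
theorem IsSchrodingerSolution.exists_equicontinuous {U : ℝ → E →L[ℂ] E}
    (hU : IsPropagator H U) (hH : IsSelfAdjoint H) (ht₀ : t₀ ∈ Icc 0 T)
    (h : ∀ i, IsSchrodingerSolution H μ (e i) t₀ (φ₀ i) (φ i))
    {C : Set E} (hC : IsCompact C) (hφC : ∀ i, ∀ t ∈ Icc 0 T, φ i t ∈ C)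
    {M : ℝ} (hM : ∀ i, ‖e i‖ ≤ M) {ε : ℝ} (hε : 0 < ε) :
    ∃ δ > 0, ∀ i, ∀ a ∈ Icc 0 T, ∀ b ∈ Icc 0 T, |b - a| < δ → ‖φ i b - φ i a‖ < ε := by
  obtain ⟨B, hB⟩ := hC.isBounded.exists_norm_le
  set L : ℝ := ‖μ‖ * |B| + 1
  have hL : 0 < L := by positivity
  -- Strong continuity at time zero is uniform on a compact set.
  have hUev : ∀ᶠ τ in 𝓝 (0 : ℝ), ∀ x ∈ C, ‖U τ x - x‖ < ε / 2 := by
    refine hC.eventually_forall_of_forall_eventually fun x _ => ?_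
    have hcont : Continuous fun z : ℝ × E => ‖U z.1 z.2 - z.2‖ :=
      (hU.continuous_uncurry.sub continuous_snd).norm
    refine hcont.continuousAt.eventually_lt_const ?_
    simp only [hU.zero, one_apply_eq_self, sub_self, norm_zero]
    positivity
  obtain ⟨δ₁, hδ₁, hUδ⟩ := Metric.eventually_nhds_iff.mp hUev
  -- In Young's inequality with weight one, this makes `κ M²` at most `ε / (2 L)`; the choice of `δ`
  -- does the same for `|b - a| / κ`.
  set κ : ℝ := ε / 2 / L / (M ^ 2 + 1) with hκdef
  have hκ : 0 < κ := by positivity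
  refine ⟨min δ₁ (κ * (ε / 2 / L)), lt_min hδ₁ (by positivity), fun i a ha b hb hab => ?_⟩
  have hsub : uIoc a b ⊆ Icc 0 T := uIoc_subset_uIcc.trans (uIcc_subset_Icc ha hb)
  have h1 : ‖U (b - a) (φ i a) - φ i a‖ < ε / 2 :=
    hUδ (by simpa using hab.trans_le (min_le_left _ _)) _ (hφC i a ha)
  have hduhamel := (h i).sub_propagator_eq_integral hU hH ht₀ ha hb
  have hcont : ContinuousOn (fun s => Complex.I • U (b - s) (μ (φ i s))) (Icc 0 T) :=
    ((h i).continuousOn_propagator hU b).const_smul Complex.I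
  have he := ((e i).intervalIntegrable ha hb).norm
  have h2 : ‖φ i b - U (b - a) (φ i a)‖ ≤ L * ∫ s in uIoc a b, ‖e i s‖ := by
    rw [hduhamel, ← integral_const_mul]
    refine intervalIntegral.norm_integral_le_integral_norm_uIoc.trans ?_
    refine setIntegral_mono_on
      (intervalIntegrable_iff.mp ((e i).intervalIntegrable_smul hcont ha hb)).norm
      ((intervalIntegrable_iff.mp he).const_mul L) measurableSet_uIoc fun s hs => ?_
    rw [norm_smul, norm_smul, Complex.norm_I, one_mul, Complex.norm_real, mul_comm, hU.norm_apply]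
    gcongr
    have h3 := μ.le_opNorm (φ i s)
    have h4 : ‖φ i s‖ ≤ |B| := (hB _ (hφC i s (hsub hs))).trans (le_abs_self B)
    have h5 : ‖μ‖ * ‖φ i s‖ ≤ ‖μ‖ * |B| := by gcongr
    linarith
  have h6 := (e i).integral_norm_mul_le (hM i) hκ (w := fun _ => 1) continuous_const ha hb
  simp only [mul_one, one_pow] at h6
  have h7 : ∫ _ in uIoc a b, (1 : ℝ) = |b - a| := by
    simp [Measure.real]
  have h8 : |b - a| / κ < ε / 2 / L := by
    rw [div_lt_iff₀ hκ, mul_comm]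
    exact hab.trans_le (min_le_right _ _)
  have h9 : κ * M ^ 2 ≤ ε / 2 / L := by
    rw [hκdef, div_mul_eq_mul_div, div_le_iff₀ (by positivity)]
    nlinarith [show 0 < ε / 2 / L by positivity]
  rw [h7] at h6
  have h10 : L * ∫ s in uIoc a b, ‖e i s‖ < ε / 2 := by
    rw [mul_comm, ← lt_div_iff₀ hL]
    linarith
  have h11 : φ i b - φ i a = (φ i b - U (b - a) (φ i a)) + (U (b - a) (φ i a) - φ i a) := by
    abel
  rw [h11]
  linarith [norm_add_le (φ i b - U (b - a) (φ i a)) (U (b - a) (φ i a) - φ i a)]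

end SolutionCompactness

/-! ### Limit points and perturbed contractions. -/

section LimitPoints

/-- In a metric space subsequential limits are the cluster points, a closed set, here inside the
compact closure of the range. -/
theorem isCompact_limitPoints_of_totallyBounded {X : Type*} [MetricSpace X] [CompleteSpace X]
    {u : ℕ → X} (h : TotallyBounded (range u)) : IsCompact (limitPoints u) := by
  have heq : limitPoints u = {a | MapClusterPt a atTop u} := by
    ext a
    constructor
    · rintro ⟨n, hn, hlim⟩
      exact hlim.mapClusterPt.of_comp hn.tendsto_atTop
    · intro ha
      exact MapClusterPt.tendsto_subseq ha
  have hclosed : IsClosed (limitPoints u) := by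
    rw [heq]
    exact isClosed_setOfPred_clusterPt
  refine (h.closure.isCompact_of_isClosed isClosed_closure).of_isClosed_subset hclosed ?_
  rintro a ⟨n, -, hlim⟩
  exact mem_closure_of_tendsto hlim (Eventually.of_forall fun j => mem_range_self _)

theorem exists_bound_of_le_mul_add {x : ℕ → ℝ} {c b : ℝ} (hc0 : 0 ≤ c) (hc : c < 1)
    (h : ∀ k, x (k + 1) ≤ c * x k + b) : ∃ M, ∀ k, x k ≤ M := by
  refine ⟨max (x 0) (b / (1 - c)), fun k => ?_⟩
  induction k with
  | zero => exact le_max_left _ _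
  | succ k ih =>
    have h1 : b ≤ (1 - c) * max (x 0) (b / (1 - c)) := by
      rw [mul_comm, ← div_le_iff₀ (by linarith)]
      exact le_max_right _ _
    have h2 : c * x k ≤ c * max (x 0) (b / (1 - c)) := by gcongr
    linarith [h k]

/-- The orbit of a contraction perturbed by vectors of a compact set is totally bounded. -/
theorem totallyBounded_range_of_contraction {X : Type*} [NormedAddCommGroup X] [NormedSpace ℝ X]
    {x b : ℕ → X} {c : ℝ} (hc : |c| < 1) {K : Set X} (hK : IsCompact K) (hb : ∀ k, b k ∈ K)
    (h : ∀ k, x (k + 1) = c • x k + b k) : TotallyBounded (range x) := by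
  obtain ⟨B, hB⟩ := hK.isBounded.exists_norm_le
  obtain ⟨M, hM⟩ := exists_bound_of_le_mul_add (x := fun k => ‖x k‖) (abs_nonneg c) hc
    (b := B) fun k => by
      rw [h k]
      refine (norm_add_le _ _).trans (add_le_add (norm_smul _ _).le (hB _ (hb k)))
  have hstep : ∀ n : ℕ, ∃ C : Set X, IsCompact C ∧ ∀ k, ∃ y ∈ C, dist (x k) y ≤ |c| ^ n * M := by
    intro n
    induction n with
    | zero => exact ⟨{0}, isCompact_singleton, fun k => ⟨0, rfl, by simpa using hM k⟩⟩
    | succ n ih =>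
      obtain ⟨C, hC, hCx⟩ := ih
      -- If `C` approximates the orbit, then `c • C + K` approximates it `|c|` times better, except
      -- at `x 0`, which has no predecessor.
      refine ⟨{x 0} ∪ (fun p : X × X => c • p.1 + p.2) '' (C ×ˢ K),
        isCompact_singleton.union ((hC.prod hK).image (by fun_prop)), fun k => ?_⟩
      cases k with
      | zero =>
        have hM0 : 0 ≤ M := (norm_nonneg _).trans (hM 0)
        exact ⟨x 0, Or.inl rfl, by rw [dist_self]; positivity⟩
      | succ k =>
        obtain ⟨y, hy, hxy⟩ := hCx k
        refine ⟨c • y + b k, Or.inr ⟨(y, b k), ⟨hy, hb k⟩, rfl⟩, ?_⟩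
        rw [h k, dist_add_right, dist_smul₀, Real.norm_eq_abs, pow_succ', mul_assoc]
        gcongr
  refine totallyBounded_of_approx fun ε hε => ?_
  have hlim : Tendsto (fun n : ℕ => |c| ^ n * M) atTop (𝓝 0) := by
    simpa using (tendsto_pow_atTop_nhds_zero_of_lt_one (abs_nonneg c) hc).mul_const M
  obtain ⟨n, hn⟩ := (hlim.eventually_lt_const hε).exists
  obtain ⟨C, hC, hCx⟩ := hstep n
  refine ⟨C, hC.totallyBounded, ?_⟩
  rintro _ ⟨k, rfl⟩
  obtain ⟨y, hy, hxy⟩ := hCx k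
  exact ⟨y, hy, hxy.trans hn.le⟩

end LimitPoints

/-! ### Ascoli's theorem in the space of controls. -/

section Ascoli

variable {T : ℝ}

theorem ControlSpace.exists_ae_eq {f : ℝ → ℝ} (hf : ContinuousOn f (Icc 0 T)) :
    ∃ x : ControlSpace T, ∀ᵐ t ∂((volume : Measure ℝ).restrict (Icc 0 T)), x t = f t := by
  obtain ⟨C, hC⟩ := isCompact_Icc.exists_bound_of_continuousOn hf
  have h : MemLp f 2 ((volume : Measure ℝ).restrict (Icc 0 T)) :=
    MemLp.of_bound (hf.aestronglyMeasurable measurableSet_Icc) C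
      ((ae_restrict_mem measurableSet_Icc).mono fun t ht => hC t ht)
  exact ⟨h.toLp f, h.coeFn_toLp⟩

/-- A uniformly bounded and uniformly equicontinuous family of functions on `[0,T]` is contained in
a compact subset of `L²([0,T])`. -/
theorem ControlSpace.exists_isCompact_of_equicontinuous {ι : Type*} (hT : 0 ≤ T)
    {x : ι → ControlSpace T} {f : ι → ℝ → ℝ}
    (hx : ∀ i, ∀ᵐ t ∂((volume : Measure ℝ).restrict (Icc 0 T)), x i t = f i t) {B : ℝ}
    (hB : ∀ i, ∀ t ∈ Icc 0 T, |f i t| ≤ B)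
    (hf : ∀ ε > 0, ∃ δ > 0, ∀ i, ∀ a ∈ Icc 0 T, ∀ b ∈ Icc 0 T, |b - a| < δ → |f i b - f i a| < ε) :
    ∃ K : Set (ControlSpace T), IsCompact K ∧ ∀ i, x i ∈ K := by
  have hcont : ∀ i, Continuous ((Icc 0 T).domRestrict (f i)) := fun i => by
    rw [Metric.continuous_iff]
    intro a ε hε
    obtain ⟨δ, hδ, hfδ⟩ := hf ε hε
    exact ⟨δ, hδ, fun b hb => hfδ i a a.2 b b.2 hb⟩
  let g : ι → BoundedContinuousFunction (Icc 0 T) ℝ := fun i =>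
    BoundedContinuousFunction.mkOfCompact ⟨_, hcont i⟩
  have hg : ∀ i (t : Icc 0 T), g i t = f i t := fun i t => rfl
  -- Ascoli is applied on the compact interval. Composing with the projection extends the functions
  -- to the line, where the measure of the control space lives, and the resulting map into `L²` is
  -- continuous.
  let p : C(ℝ, Icc 0 T) := ⟨projIcc 0 T hT, continuous_projIcc⟩
  let Φ : BoundedContinuousFunction (Icc 0 T) ℝ → ControlSpace T := fun u =>
    BoundedContinuousFunction.toLp 2 ((volume : Measure ℝ).restrict (Icc 0 T)) ℝ (u.compContinuous p)
  have hΦ : Continuous Φ :=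
    (BoundedContinuousFunction.toLp 2 ((volume : Measure ℝ).restrict (Icc 0 T)) ℝ).continuous.comp
      (BoundedContinuousFunction.continuous_compContinuous p)
  have hcompact : IsCompact (closure (range g)) := by
    refine BoundedContinuousFunction.arzela_ascoli (Metric.closedBall 0 B)
      (isCompact_closedBall _ _) _ ?_ ?_
    · rintro _ t ⟨i, rfl⟩
      rw [mem_closedBall_zero_iff, hg]
      exact hB i t t.2
    · intro a
      rw [Metric.equicontinuousAt_iff]
      intro ε hε
      obtain ⟨δ, hδ, hfδ⟩ := hf ε hε
      refine ⟨δ, hδ, ?_⟩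
      rintro b hb ⟨_, i, rfl⟩
      rw [dist_comm]
      exact hfδ i a a.2 b b.2 hb
  refine ⟨Φ '' closure (range g), hcompact.image hΦ, fun i =>
    ⟨g i, subset_closure (mem_range_self i), ?_⟩⟩
  refine Lp.ext ?_
  filter_upwards [hx i, BoundedContinuousFunction.coeFn_toLp (p := 2) (𝕜 := ℝ)
    ((volume : Measure ℝ).restrict (Icc 0 T)) ((g i).compContinuous p),
    ae_restrict_mem measurableSet_Icc] with t h1 h2 h3
  rw [h1, h2]
  have h4 : p t = ⟨t, h3⟩ := projIcc_of_mem hT h3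
  rw [BoundedContinuousFunction.compContinuous_apply, h4, hg]

end Ascoli

/-! ### The monotonic scheme. -/

section Scheme

variable {E : Type*} [NormedAddCommGroup E] [InnerProductSpace ℂ E]

theorem exists_equicontinuous_im_inner (μ : E →L[ℂ] E) {T : ℝ} {ι : Type*} {χ ψ : ι → ℝ → E}
    {B D : ℝ} (hχB : ∀ i, ∀ t ∈ Icc 0 T, ‖χ i t‖ ≤ B) (hψD : ∀ i, ∀ t ∈ Icc 0 T, ‖ψ i t‖ ≤ D)
    (hχ : ∀ ε > 0, ∃ δ > 0, ∀ i, ∀ a ∈ Icc 0 T, ∀ b ∈ Icc 0 T, |b - a| < δ → ‖χ i b - χ i a‖ < ε)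
    (hψ : ∀ ε > 0, ∃ δ > 0, ∀ i, ∀ a ∈ Icc 0 T, ∀ b ∈ Icc 0 T, |b - a| < δ → ‖ψ i b - ψ i a‖ < ε)
    {ε : ℝ} (hε : 0 < ε) :
    ∃ δ > 0, ∀ i, ∀ a ∈ Icc 0 T, ∀ b ∈ Icc 0 T, |b - a| < δ →
      |(inner ℂ (χ i b) (μ (ψ i b))).im - (inner ℂ (χ i a) (μ (ψ i a))).im| < ε := by
  set L : ℝ := ‖μ‖ * (|B| + |D|) + 1
  have hL : 0 < L := by positivity
  obtain ⟨δ₁, hδ₁, h₁⟩ := hχ (ε / L) (by positivity)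
  obtain ⟨δ₂, hδ₂, h₂⟩ := hψ (ε / L) (by positivity)
  refine ⟨min δ₁ δ₂, lt_min hδ₁ hδ₂, fun i a ha b hb hab => ?_⟩
  have h3 := h₁ i a ha b hb (hab.trans_le (min_le_left _ _))
  have h4 := h₂ i a ha b hb (hab.trans_le (min_le_right _ _))
  have h5 : (inner ℂ (χ i b) (μ (ψ i b)) : ℂ) - inner ℂ (χ i a) (μ (ψ i a)) =
      inner ℂ (χ i b - χ i a) (μ (ψ i b)) + inner ℂ (χ i a) (μ (ψ i b - ψ i a)) := by
    rw [inner_sub_left, map_sub, inner_sub_right]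
    ring
  rw [← Complex.sub_im, h5]
  have h6 : ‖(inner ℂ (χ i b - χ i a) (μ (ψ i b)) : ℂ)‖ ≤ ε / L * (‖μ‖ * |D|) := by
    refine (norm_inner_le_norm _ _).trans (mul_le_mul h3.le ((μ.le_opNorm _).trans ?_)
      (norm_nonneg _) (by positivity))
    gcongr
    exact (hψD i b hb).trans (le_abs_self D)
  have h7 : ‖(inner ℂ (χ i a) (μ (ψ i b - ψ i a)) : ℂ)‖ ≤ |B| * (‖μ‖ * (ε / L)) := by
    refine (norm_inner_le_norm _ _).trans (mul_le_mul ((hχB i a ha).trans (le_abs_self B))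
      ((μ.le_opNorm _).trans ?_) (norm_nonneg _) (by positivity))
    gcongr
  have h8 : ε / L * (L - 1) < ε := by
    have : ε / L * L = ε := by field_simp
    nlinarith [show 0 < ε / L by positivity]
  have h9 := (Complex.abs_im_le_norm (inner ℂ (χ i b - χ i a) (μ (ψ i b)) +
    inner ℂ (χ i a) (μ (ψ i b - ψ i a)))).trans (norm_add_le _ _)
  have h10 : ε / L * (L - 1) = ε / L * (‖μ‖ * |D|) + |B| * (‖μ‖ * (ε / L)) := by
    simp only [L]; ring
  linarith

theorem abs_im_inner_apply_le (μ : E →L[ℂ] E) {x y : E} {B D : ℝ} (hx : ‖x‖ ≤ B) (hy : ‖y‖ ≤ D) :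
    |(inner ℂ x (μ y) : ℂ).im| ≤ B * (‖μ‖ * D) := by
  refine (Complex.abs_im_le_norm _).trans ((norm_inner_le_norm _ _).trans ?_)
  exact mul_le_mul hx ((μ.le_opNorm _).trans (by gcongr)) (norm_nonneg _)
    ((norm_nonneg _).trans hx)

theorem continuousOn_im_inner_apply (μ : E →L[ℂ] E) {χ ψ : ℝ → E} {s : Set ℝ}
    (hχ : ContinuousOn χ s) (hψ : ContinuousOn ψ s) :
    ContinuousOn (fun t => (inner ℂ (χ t) (μ (ψ t)) : ℂ).im) s :=
  Complex.continuous_im.comp_continuousOn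
    (hχ.inner (μ.continuous.comp_continuousOn hψ))

variable {H : E →ₗ.[ℂ] E} {μ O : E →L[ℂ] E} {ψ₀ : E} {T α δ η : ℝ}
  {ε ε' : ℕ → ControlSpace T} {ψ χ : ℕ → ℝ → E}

/-- Both updates copy the previous control. Only `ε' 0` is arbitrary, so `ε 0` may differ from all
later terms, which equal `ε 1`. -/
theorem IsMonotonicScheme.totallyBounded_range_of_zero
    (h : IsMonotonicScheme H μ O ψ₀ T α 0 0 ε ε' ψ χ) : TotallyBounded (range ε) := by
  have hconst : ∀ k, ε (k + 1) = ε 1 := by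
    intro k
    induction k with
    | zero => rfl
    | succ k ih =>
      rw [← ih]
      refine Lp.ext ?_
      filter_upwards [h.control (k + 1), h.adjointControl (k + 1) (Nat.le_add_left 1 k)]
        with t e1 e2
      rw [e1, e2]
      ring
  refine (Set.toFinite {ε 0, ε 1}).totallyBounded.subset ?_
  rintro _ ⟨_ | k, rfl⟩
  · exact Or.inl rfl
  · exact Or.inr (hconst k)

theorem IsMonotonicScheme.totallyBounded_range [CompleteSpace E] (hH : IsSelfAdjoint H) (hμ : IsSelfAdjoint μ)
    (hT : 0 < T) (hδη : |(1 - δ) * (1 - η)| < 1)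
    (h : IsMonotonicScheme H μ O ψ₀ T α δ η ε ε' ψ χ) : TotallyBounded (range ε) := by
  have h0 : (0 : ℝ) ∈ Icc 0 T := ⟨le_rfl, hT.le⟩
  have h1 : T ∈ Icc 0 T := ⟨hT.le, le_rfl⟩
  have hψn : ∀ k, ∀ t ∈ Icc 0 T, ‖ψ k t‖ ≤ ‖ψ₀‖ := fun k t ht =>
    ((h.state k).norm_eq hH hμ h0 ht).le
  have hχn : ∀ k, ∀ t ∈ Icc 0 T, ‖χ k t‖ ≤ ‖O‖ * ‖ψ₀‖ := fun k t ht => by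
    rw [(h.adjointState k).norm_eq hH hμ h1 ht]
    exact (O.le_opNorm _).trans (by gcongr; exact hψn k T h1)
  choose f hf using fun k => ControlSpace.exists_ae_eq (continuousOn_im_inner_apply
    μ (h.adjointState k).continuousOn (h.state (k + 1)).continuousOn)
  choose g hg using fun k => ControlSpace.exists_ae_eq (continuousOn_im_inner_apply
    μ (h.adjointState k).continuousOn (h.state k).continuousOn)
  have hε : ∀ k, ε (k + 1) = (1 - δ) • ε' k - (δ / α) • f k := fun k => by
    refine Lp.ext ?_
    filter_upwards [h.control k, hf k, Lp.coeFn_sub ((1 - δ) • ε' k) ((δ / α) • f k),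
      Lp.coeFn_smul (1 - δ) (ε' k), Lp.coeFn_smul (δ / α) (f k)] with t e1 e2 e3 e4 e5
    rw [e1, e3, Pi.sub_apply, e4, e5, Pi.smul_apply, Pi.smul_apply, e2, smul_eq_mul, smul_eq_mul]
  have hε' : ∀ k, ε' (k + 1) = (1 - η) • ε (k + 1) - (η / α) • g (k + 1) := fun k => by
    refine Lp.ext ?_
    filter_upwards [h.adjointControl (k + 1) (Nat.le_add_left 1 k), hg (k + 1),
      Lp.coeFn_sub ((1 - η) • ε (k + 1)) ((η / α) • g (k + 1)),
      Lp.coeFn_smul (1 - η) (ε (k + 1)), Lp.coeFn_smul (η / α) (g (k + 1))] with t e1 e2 e3 e4 e5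
    rw [e1, e3, Pi.sub_apply, e4, e5, Pi.smul_apply, Pi.smul_apply, e2, smul_eq_mul, smul_eq_mul]
  set b : ℕ → ControlSpace T := fun k =>
    -((1 - δ) * (η / α)) • g (k + 1) - (δ / α) • f (k + 1) with hb
  -- The recursion starts at `ε 1`, since `ε' 0` is not given by the update formula.
  have hrec : ∀ k, ε (k + 1 + 1) = ((1 - δ) * (1 - η)) • ε (k + 1) + b k := fun k => by
    rw [hε (k + 1), hε' k, hb]
    module
  -- These bounds rest on conservation of the norm alone, so bounding the controls with them is not
  -- circular.
  obtain ⟨Bf, hBf⟩ : ∃ B, ∀ k, ‖f k‖ ≤ B := ⟨_, fun k => Lp.norm_le_of_ae_bound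
    (C := ‖O‖ * ‖ψ₀‖ * (‖μ‖ * ‖ψ₀‖)) (by positivity) (by
      filter_upwards [hf k, ae_restrict_mem measurableSet_Icc] with t e1 ht
      rw [e1]
      exact abs_im_inner_apply_le μ (hχn k t ht) (hψn (k + 1) t ht))⟩
  obtain ⟨Bg, hBg⟩ : ∃ B, ∀ k, ‖g k‖ ≤ B := ⟨_, fun k => Lp.norm_le_of_ae_bound
    (C := ‖O‖ * ‖ψ₀‖ * (‖μ‖ * ‖ψ₀‖)) (by positivity) (by
      filter_upwards [hg k, ae_restrict_mem measurableSet_Icc] with t e1 ht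
      rw [e1]
      exact abs_im_inner_apply_le μ (hχn k t ht) (hψn k t ht))⟩
  obtain ⟨M₁, hM₁⟩ := exists_bound_of_le_mul_add (x := fun k => ‖ε (k + 1)‖) (abs_nonneg _) hδη
    (b := ‖-((1 - δ) * (η / α))‖ * Bg + ‖δ / α‖ * Bf) fun k => by
      rw [hrec k]
      refine (norm_add_le _ _).trans (add_le_add (norm_smul _ _).le ((norm_sub_le _ _).trans ?_))
      rw [norm_smul, norm_smul]
      gcongr
      · exact hBg _
      · exact hBf _
  have hM : ∀ k, ‖ε k‖ ≤ max ‖ε 0‖ M₁ := by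
    rintro (_ | k)
    · exact le_max_left _ _
    · exact (hM₁ k).trans (le_max_right _ _)
  have hM' : ∀ k, ‖ε' k‖ ≤ max ‖ε' 0‖ (‖1 - η‖ * M₁ + ‖η / α‖ * Bg) := by
    rintro (_ | k)
    · exact le_max_left _ _
    · refine le_trans ?_ (le_max_right _ _)
      rw [hε' k]
      refine (norm_sub_le _ _).trans ?_
      rw [norm_smul, norm_smul]
      gcongr
      · exact hM₁ k
      · exact hBg _
  obtain ⟨U, hU⟩ := exists_isPropagator hH
  obtain ⟨Cψ, hCψ, hψC⟩ := IsSchrodingerSolution.exists_isCompact_values hU hH h0 h.state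
    isCompact_singleton (fun _ => mem_singleton ψ₀) hψn hM
  -- The final data `O (ψ k T)` vary with `k`; they lie in the image under `O` of the compact set
  -- already found for `ψ`.
  obtain ⟨Cχ, hCχ, hχC⟩ := IsSchrodingerSolution.exists_isCompact_values hU hH h1 h.adjointState
    (hCψ.image O.continuous) (fun k => mem_image_of_mem O (hψC k T h1)) hχn hM'
  have hψe := fun r (hr : 0 < r) =>
    IsSchrodingerSolution.exists_equicontinuous hU hH h0 h.state hCψ hψC hM hr
  have hχe := fun r (hr : 0 < r) =>
    IsSchrodingerSolution.exists_equicontinuous hU hH h1 h.adjointState hCχ hχC hM' hr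
  obtain ⟨Kf, hKf, hfK⟩ := ControlSpace.exists_isCompact_of_equicontinuous hT.le hf
    (fun k t ht => abs_im_inner_apply_le μ (hχn k t ht) (hψn (k + 1) t ht))
    fun r hr => exists_equicontinuous_im_inner μ hχn (fun k => hψn (k + 1)) hχe
      (fun r hr => (hψe r hr).imp fun _ hd => ⟨hd.1, fun k => hd.2 (k + 1)⟩) hr
  obtain ⟨Kg, hKg, hgK⟩ := ControlSpace.exists_isCompact_of_equicontinuous hT.le hg
    (fun k t ht => abs_im_inner_apply_le μ (hχn k t ht) (hψn k t ht))
    fun r hr => exists_equicontinuous_im_inner μ hχn hψn hχe hψe hr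
  have hK : IsCompact ((fun p : ControlSpace T × ControlSpace T =>
      -((1 - δ) * (η / α)) • p.1 - (δ / α) • p.2) '' (Kg ×ˢ Kf)) :=
    (hKg.prod hKf).image (by fun_prop)
  have htb := totallyBounded_range_of_contraction (x := fun k => ε (k + 1)) hδη hK
    (fun k => ⟨(g (k + 1), f (k + 1)), ⟨hgK _, hfK _⟩, rfl⟩) hrec
  refine (totallyBounded_singleton (ε 0)).union htb |>.subset ?_
  rintro _ ⟨_ | k, rfl⟩
  · exact Or.inl rfl
  · exact Or.inr ⟨k, rfl⟩

/-- Apart from the excluded corners, the factor `(1 - δ) (1 - η)` of the scheme is a contraction,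
unless both relaxation parameters vanish. -/
theorem abs_one_sub_mul_one_sub_lt_one_or (hδ : δ ∈ Icc (0 : ℝ) 2) (hη : η ∈ Icc (0 : ℝ) 2)
    (hδη : (δ, η) ∉ ({(0, 2), (2, 0), (2, 2)} : Set (ℝ × ℝ))) :
    |(1 - δ) * (1 - η)| < 1 ∨ (δ = 0 ∧ η = 0) := by
  have h1 : |1 - δ| ≤ 1 := abs_le.mpr ⟨by linarith [hδ.2], by linarith [hδ.1]⟩
  have h2 : |1 - η| ≤ 1 := abs_le.mpr ⟨by linarith [hη.2], by linarith [hη.1]⟩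
  by_contra! hcon
  obtain ⟨h3, h4⟩ := hcon
  rw [abs_mul] at h3
  have h5 : |1 - δ| = 1 := by nlinarith [abs_nonneg (1 - δ), abs_nonneg (1 - η)]
  have h6 : |1 - η| = 1 := by nlinarith [abs_nonneg (1 - δ), abs_nonneg (1 - η)]
  have hδ' : δ = 0 ∨ δ = 2 := by
    rcases (abs_eq zero_le_one).mp h5 with h | h
    · left; linarith
    · right; linarith
  have hη' : η = 0 ∨ η = 2 := by
    rcases (abs_eq zero_le_one).mp h6 with h | h
    · left; linarith
    · right; linarith
  rcases hδ' with rfl | rfl <;> rcases hη' with rfl | rfl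
  · exact h4 rfl rfl
  · exact hδη (by simp)
  · exact hδη (by simp)
  · exact hδη (by simp)

end Scheme

end

theorem mainTheorem4 {N : ℕ} (Ω : Set (EuclideanSpace ℝ (Fin N))) (hΩ : MeasurableSet Ω)
    (H : StateSpace Ω →ₗ.[ℂ] StateSpace Ω) (hH : IsSelfAdjoint H)
    (μ O : StateSpace Ω →L[ℂ] StateSpace Ω) (hμ : IsSelfAdjoint μ) (hO : IsSelfAdjoint O)
    (ψ₀ : StateSpace Ω) (T α δ η : ℝ) (hT : 0 < T) (hα : 0 < α)
    (hδ : δ ∈ Icc (0 : ℝ) 2) (hη : η ∈ Icc (0 : ℝ) 2)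
    (hδη : (δ, η) ∉ ({(0, 2), (2, 0), (2, 2)} : Set (ℝ × ℝ)))
    (ε ε' : ℕ → ControlSpace T) (ψ χ : ℕ → ℝ → StateSpace Ω)
    (hscheme : IsMonotonicScheme H μ O ψ₀ T α δ η ε ε' ψ χ) :
    IsCompact (limitPoints ε) := by
  refine isCompact_limitPoints_of_totallyBounded ?_
  rcases abs_one_sub_mul_one_sub_lt_one_or hδ hη hδη with hc | ⟨rfl, rfl⟩
  · exact hscheme.totallyBounded_range hH hμ hT hc
  · exact hscheme.totallyBounded_range_of_zero
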